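/- All graphs are finite and simple, and $\mu(G)$ denotes the number of edges of a maximum matching of $G$. For integers $\beta > \beta^- \ge 1$, a subgraph $H$ of a graph $G$ (on the same vertex set) is a $(\beta,\beta^-)$-EDCS of $G$ if $\deg_H(u)+\deg_H(v) \le \beta$ for every edge $(u,v)$ of $H$, and $\deg_H(u)+\deg_H(v) \ge \beta^-$ for every edge $(u,v)$ of $G$ that is not in $H$. Let $A$, $L\setminus A$, $N(A)$, $R\setminus N(A)$, $M$, $M^*$, $H$ be formal labels. A *valid vertex profile* $\mathsf v$ consists of a position in $\{A,\ L\setminus A,\ N(A),\ R\setminus N(A)\}$, a degree $\mathsf v_{\deg} \in \{0,\dots,\beta-1\}$, a flag "matched in $M$" and a flag "matched in $M^*$", such that (1) if the position is $N(A)$ or $L\setminus A$, then $\mathsf v$ is matched in $M$; (2) if $\mathsf v_{\deg}=0$, then $\mathsf v$ is not matched in $M$. Let $VP$ be the set of valid vertex profiles. A *valid edge profile* $\mathsf e$ consists of two valid vertex profiles (its endpoints), the left one with position $A$ or $L\setminus A$ and the right one with position $N(A)$ or $R\setminus N(A)$, and three flags "in $H$", "in $M$", "in $M^*$", such that (3)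 if $\mathsf e$ is in $H$, both endpoints have nonzero degree; (4) if $\mathsf e$ is in $M$ (resp. in $M^*$), both endpoints are matched in $M$ (resp. in $M^*$); (5) if $\mathsf e$ is in $M$, it is in $H$; (6) $\mathsf e$ is in $H$ or in $M^*$; (7) if $\mathsf e$ is in $H$, the degrees of its endpoints sum to at most $\beta$; (8) if $\mathsf e$ is not in $H$, the degrees of its endpoints sum to at least $\beta^-$; (9) if $\mathsf e$ is in $H$, its endpoints do not have positions $A$ and $R\setminus N(A)$; (10) if $\mathsf e$ is in $M$, exactly one of the following holds: its right endpoint has position $N(A)$, or its left endpoint has position $L\setminus A$. Let $EP$ be the set of valid edge profiles. For $\mathsf v\in VP$ let $H(\mathsf v)$, $M(\mathsf v)$, $M^*(\mathsf v)$ be the sets of $\mathsf e \in EP$ that are in $H$, $M$, $M^*$ respectively and have $\mathsf v$ as one of their endpoints. Consider the linear program in real variables $x_{\mathsf v}\ge 0$ ($\mathsf v\in VP$) and $x_{\mathsf e}\ge 0$ ($\mathsf e\in EP$): $$\text{maximize}\ \sum_{\mathsf e\in EP,\ \mathsf e\in M^*} x_{\mathsf e}$$ subject to $$\sum_{\mathsf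 e\in H(\mathsf v)} x_{\mathsf e} = \mathsf v_{\deg}\, x_{\mathsf v}\quad (\mathsf v\in VP),\qquad \sum_{\mathsf e\in M(\mathsf v)} x_{\mathsf e} = x_{\mathsf v}\quad (\mathsf v\in VP \text{ matched in } M),$$ $$\sum_{\mathsf e\in M^*(\mathsf v)} x_{\mathsf e} = x_{\mathsf v}\quad (\mathsf v\in VP \text{ matched in } M^*),\qquad \sum_{\mathsf e\in EP,\ \mathsf e \in M} x_{\mathsf e} = 1 .$$ **Theorem.** Let $\beta > \beta^- \ge 1$ be integers. The linear program has an optimal solution, and its optimal value $r$ is the worst-case approximation ratio of a $(\beta,\beta^-)$-EDCS on bipartite graphs: for every bipartite graph $G$ and every $(\beta,\beta^-)$-EDCS $H$ of $G$ we have $\mu(G)\le r\cdot\mu(H)$, and there are a bipartite graph $G$ and a $(\beta,\beta^-)$-EDCS $H$ of $G$ with $\mu(H)>0$ and $\mu(G)=r\cdot\mu(H)$. -/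

import Mathlib

namespace EDCS

/-! ### Graphs -/

/-- The size `μ(G)` of a maximum matching: the largest number of edges of a matching of `G`. -/
noncomputable def matchingNumber {V : Type*} [Fintype V] (G : SimpleGraph V) : ℕ :=
  sSup {n : ℕ | ∃ M : G.Subgraph, M.IsMatching ∧ M.edgeSet.ncard = n}

/-- `H` is an edge-degree constrained subgraph of `G` with parameters `(β, β⁻)`. -/
structure IsEDCS {V : Type*} [Fintype V] (β βm : ℕ) (G H : SimpleGraph V)
    [DecidableRel H.Adj] : Prop where
  le : H ≤ G
  deg_add_le : ∀ u v, H.Adj u v → H.degree u + H.degree v ≤ β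
  le_deg_add : ∀ u v, G.Adj u v → ¬ H.Adj u v → βm ≤ H.degree u + H.degree v

/-! ### Vertex profiles and edge profiles

`A` is a Hall witness for `H`, `M` a maximum matching of `H` and `M*` one of `G`. -/

/-- The position of a vertex: in `A`, `L \ A`, `N_H(A)` or `R \ N_H(A)`. -/
inductive Pos
  | A
  | LdiffA
  | NA
  | RdiffNA
  deriving DecidableEq

instance : Fintype Pos where
  elems := {Pos.A, Pos.LdiffA, Pos.NA, Pos.RdiffNA}
  complete := by intro p; cases p <;> decide

/-- A position on the side `L`. -/
def Pos.InL (p : Pos) : Prop := p = Pos.A ∨ p = Pos.LdiffA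

/-- A position on the side `R`. -/
def Pos.InR (p : Pos) : Prop := p = Pos.NA ∨ p = Pos.RdiffNA

instance (p : Pos) : Decidable p.InL := inferInstanceAs (Decidable (_ ∨ _))

instance (p : Pos) : Decidable p.InR := inferInstanceAs (Decidable (_ ∨ _))

/-- The properties of a vertex that its profile records. -/
structure VertexProfile (β : ℕ) where
  pos : Pos
  /-- the degree in `H`, between `0` and `β - 1` -/
  deg : Fin β
  /-- matched in `M` -/
  inM : Bool
  /-- matched in `M*` -/
  inMstar : Bool
  deriving DecidableEq, Fintype

/-- Validity of a vertex profile: a vertex of `N_H(A)` or of `L \ A` is matched in `M`, and a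
vertex of degree zero is not matched in `M`. -/
def VertexProfile.Valid {β : ℕ} (v : VertexProfile β) : Prop :=
  ((v.pos = Pos.NA ∨ v.pos = Pos.LdiffA) → v.inM = true) ∧
  ((v.deg : ℕ) = 0 → v.inM = false)

instance {β : ℕ} (v : VertexProfile β) : Decidable v.Valid := inferInstanceAs (Decidable (_ ∧ _))

/-- The set `VP` of valid vertex profiles. -/
abbrev VP (β : ℕ) : Type := {v : VertexProfile β // v.Valid}

/-- The properties of an edge that its profile records. -/
structure EdgeProfile (β : ℕ) where
  /-- the vertex profile of the endpoint in `L` -/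
  left : VP β
  /-- the vertex profile of the endpoint in `R` -/
  right : VP β
  inH : Bool
  inM : Bool
  inMstar : Bool
  deriving DecidableEq, Fintype

/-- Validity of an edge profile. -/
def EdgeProfile.Valid {β : ℕ} (βm : ℕ) (e : EdgeProfile β) : Prop :=
  -- the endpoints lie in `L` and in `R`
  (e.left.1.pos.InL ∧ e.right.1.pos.InR) ∧
  -- the endpoints of an edge of `H` have nonzero degree in `H`
  (e.inH = true → (e.left.1.deg : ℕ) ≠ 0 ∧ (e.right.1.deg : ℕ) ≠ 0) ∧
  -- the endpoints of an edge of `M` (of `M*`) are matched in `M` (in `M*`)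
  (e.inM = true → e.left.1.inM = true ∧ e.right.1.inM = true) ∧
  (e.inMstar = true → e.left.1.inMstar = true ∧ e.right.1.inMstar = true) ∧
  -- an edge of `M` is in `H`
  (e.inM = true → e.inH = true) ∧
  -- there are no edges outside `H ∪ M*`
  (e.inH = true ∨ e.inMstar = true) ∧
  -- the two degree conditions of an EDCS
  (e.inH = true → (e.left.1.deg : ℕ) + (e.right.1.deg : ℕ) ≤ β) ∧
  (e.inH = false → βm ≤ (e.left.1.deg : ℕ) + (e.right.1.deg : ℕ)) ∧
  -- there are no edges of `H` between `A` and `R \ N_H(A)`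
  (e.inH = true → ¬ (e.left.1.pos = Pos.A ∧ e.right.1.pos = Pos.RdiffNA)) ∧
  -- an edge of `M` either has an endpoint in `N_H(A)` or one in `L \ A`, not both
  (e.inM = true → Xor (e.right.1.pos = Pos.NA) (e.left.1.pos = Pos.LdiffA))

instance {β : ℕ} (βm : ℕ) (e : EdgeProfile β) : Decidable (e.Valid βm) := by
  unfold EdgeProfile.Valid; infer_instance

/-- The set `EP` of valid edge profiles. -/
abbrev EP (β βm : ℕ) : Type := {e : EdgeProfile β // e.Valid βm}

/-- One of the endpoints of the edge profile `e` has the vertex profile `v`. -/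
def EdgeProfile.Touches {β : ℕ} (e : EdgeProfile β) (v : VP β) : Prop :=
  e.left = v ∨ e.right = v

instance {β : ℕ} (e : EdgeProfile β) (v : VP β) : Decidable (e.Touches v) :=
  inferInstanceAs (Decidable (_ ∨ _))

/-! ### The factor-revealing linear program -/

/-- Feasibility of an assignment of real values to the variables: `x v` for the vertex profiles
`v ∈ VP` and `y e` for the edge profiles `e ∈ EP`. -/
structure LPFeasible (β βm : ℕ) (x : VP β → ℝ) (y : EP β βm → ℝ) : Prop where
  sum_H : ∀ v : VP β,
    ∑ e : EP β βm with e.1.inH = true ∧ e.1.Touches v, y e = ((v.1.deg : ℕ) : ℝ) * x v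
  sum_M : ∀ v : VP β, v.1.inM = true →
    ∑ e : EP β βm with e.1.inM = true ∧ e.1.Touches v, y e = x v
  sum_Mstar : ∀ v : VP β, v.1.inMstar = true →
    ∑ e : EP β βm with e.1.inMstar = true ∧ e.1.Touches v, y e = x v
  sum_M_eq_one : ∑ e : EP β βm with e.1.inM = true, y e = 1
  edge_nonneg : ∀ e, 0 ≤ y e
  vertex_nonneg : ∀ v, 0 ≤ x v

/-- The objective of the linear program: the total value of the edge profiles in `M*`. -/
noncomputable def lpObjective (β βm : ℕ) (y : EP β βm → ℝ) : ℝ :=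
  ∑ e : EP β βm with e.1.inMstar = true, y e

/-- `r` is the optimal value of the linear program: the maximum of the objective over all feasible
solutions (attained, and an upper bound). -/
def IsLPOptimalValue (β βm : ℕ) (r : ℝ) : Prop :=
  IsGreatest {t : ℝ | ∃ (x : VP β → ℝ) (y : EP β βm → ℝ),
    LPFeasible β βm x y ∧ lpObjective β βm y = t} r

end EDCS

/-! The constraints of the program count incidences between profiles, so feasible solutions
correspond, up to scaling, to pairs of a bipartite graph and an EDCS. Both directions of this
correspondence are proved.

From graphs to solutions (`IsEDCS.exists_lpFeasible`): a minimum vertex cover `C` of `H`, which has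
size `μ(H)` by König's theorem, takes the role of the Hall witness, with `A = L \ C`. Counting
vertices and edges by profile and dividing by `μ(H)` gives a feasible solution with objective `μ(G)
/ μ(H)`. This bounds `μ(G)` by `r * μ(H)`.

From solutions to graphs: the optimum is attained by compactness (`exists_isLPOptimalValue`).
Applying a `ℚ`-linear map `ℝ → ℚ` close to the identity and clearing denominators turns an optimal
solution into natural numbers without changing the ratio (`IsLPOptimalValue.exists_nat`). These are
read as multiplicities, and the ends of the edges are distributed evenly over the copies of each
profile (`exists_distribution`), which gives a multigraph. A cover with fibre `(ZMod 2)^E` makes it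
simple and keeps all degrees (`liftGraph`). There the positions `N(A)` and `L \ A` form a vertex
cover that bounds `μ(H)` from above, and the edges of `M*` bound `μ(G)` from below. Together with
the first direction the ratio is exactly `r`. -/

namespace EDCS

/-! ### Matchings, vertex covers and König's theorem -/

open scoped Classical in
/-- The number of ordered pairs `(a, b)` with `a ∈ L` that are adjacent in a bipartite graph. -/
theorem ncard_edgeSet_eq_card_pairs {V : Type*} [Fintype V] {K : SimpleGraph V} {L : Set V}
    (hL : ∀ a b, K.Adj a b → (a ∈ L ↔ b ∉ L)) :
    K.edgeSet.ncard = Fintype.card {p : V × V // p.1 ∈ L ∧ K.Adj p.1 p.2} := by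
  rw [← Nat.card_coe_set_eq, Nat.card_eq_fintype_card]
  symm
  refine Fintype.card_of_bijective (f := fun p => ⟨s(p.1.1, p.1.2), p.2.2⟩) ⟨?_, ?_⟩
  · rintro ⟨⟨a, b⟩, ha, hab⟩ ⟨⟨c, d⟩, hc, hcd⟩ h
    rcases Sym2.eq_iff.1 (congrArg Subtype.val h) with ⟨rfl, rfl⟩ | ⟨rfl, rfl⟩
    · rfl
    · exact absurd hc ((hL _ _ hab).1 ha)
  · rintro ⟨e, he⟩
    induction e with
    | _ a b =>
      have hab : K.Adj a b := he
      by_cases ha : a ∈ L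
      · exact ⟨⟨(a, b), ha, hab⟩, rfl⟩
      · refine ⟨⟨(b, a), ?_, hab.symm⟩, Subtype.ext Sym2.eq_swap⟩
        by_contra hb
        exact ha ((hL _ _ hab).2 hb)

/-- Every vertex has at most one neighbour. -/
def UniqueNeighbors {V : Type*} (K : SimpleGraph V) : Prop :=
  ∀ ⦃a b c⦄, K.Adj a b → K.Adj a c → b = c

/-- Needed because `sSup` of an unbounded set of naturals is the default value 0. -/
theorem bddAbove_matching {V : Type*} [Fintype V] (G : SimpleGraph V) :
    BddAbove {n : ℕ | ∃ M : G.Subgraph, M.IsMatching ∧ M.edgeSet.ncard = n} := by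
  refine ⟨G.edgeSet.ncard, ?_⟩
  rintro n ⟨M, -, rfl⟩
  exact Set.ncard_le_ncard M.edgeSet_subset (Set.toFinite _)

theorem ncard_le_matchingNumber {V : Type*} [Fintype V] {G K : SimpleGraph V} (hK : K ≤ G)
    (hu : UniqueNeighbors K) : K.edgeSet.ncard ≤ matchingNumber G := by
  refine le_csSup (bddAbove_matching G) ⟨
    { verts := K.support, Adj := K.Adj, adj_sub := fun h => hK h,
      edge_vert := fun h => ⟨_, h⟩, symm := K.symm }, ?_, ?_⟩
  · rintro v ⟨w, hw⟩
    exact ⟨w, hw, fun y hy => hu hy hw⟩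
  · congr 1

theorem exists_maximum_matching {V : Type*} [Fintype V] (G : SimpleGraph V) :
    ∃ K ≤ G, UniqueNeighbors K ∧ K.edgeSet.ncard = matchingNumber G := by
  obtain ⟨M, hM, hn⟩ := Nat.sSup_mem (s := {n : ℕ | ∃ M : G.Subgraph,
    M.IsMatching ∧ M.edgeSet.ncard = n}) ⟨0, ⊥, by intro v hv; exact hv.elim, by simp⟩
    (bddAbove_matching G)
  refine ⟨M.spanningCoe, M.spanningCoe_le, fun a b c h1 h2 => hM.eq_of_adj_left h1 h2, ?_⟩
  rw [SimpleGraph.Subgraph.edgeSet_spanningCoe]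
  exact hn

open scoped Classical in
/-- A choice, for every edge of a matching, of an endpoint in a vertex cover. -/
theorem exists_injective_to_cover {V : Type*} {K : SimpleGraph V} {L : Set V}
    (hL : ∀ a b, K.Adj a b → (a ∈ L ↔ b ∉ L)) (hu : UniqueNeighbors K) {C : Finset V}
    (hC : ∀ a b, K.Adj a b → a ∈ C ∨ b ∈ C) :
    ∃ t : {p : V × V // p.1 ∈ L ∧ K.Adj p.1 p.2} → C, t.Injective ∧
      ∀ p, (t p : V) = p.1.1 ∨ (t p : V) = p.1.2 := by
  have h1 : ∀ p : {p : V × V // p.1 ∈ L ∧ K.Adj p.1 p.2}, ∃ c : C,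
      (c : V) = p.1.1 ∨ (c : V) = p.1.2 := fun p => by
    rcases hC _ _ p.2.2 with h | h
    · exact ⟨⟨_, h⟩, Or.inl rfl⟩
    · exact ⟨⟨_, h⟩, Or.inr rfl⟩
  choose t ht using h1
  refine ⟨t, ?_, ht⟩
  rintro ⟨⟨a, b⟩, ha, hab⟩ ⟨⟨c, d⟩, hc, hcd⟩ h
  have h1 := ht ⟨⟨a, b⟩, ha, hab⟩
  have h2 := ht ⟨⟨c, d⟩, hc, hcd⟩
  rw [← h] at h2
  simp only at ha hab hc hcd h1 h2
  have hb := (hL _ _ hab).1 ha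
  have hd := (hL _ _ hcd).1 hc
  -- A common endpoint forces two matching edges to coincide; the mixed cases would put it on both
  -- sides.
  rcases h1 with h1 | h1 <;> rcases h2 with h2 | h2 <;> rw [h1] at h2
  · subst h2; cases hu hab hcd; rfl
  · subst h2; exact absurd ha hd
  · subst h2; exact absurd hc hb
  · subst h2; cases hu hab.symm hcd.symm; rfl

/-- Weak duality: distinct edges of a matching use distinct vertices of the cover. -/
theorem matchingNumber_le_card_cover {V : Type*} [Fintype V] {G : SimpleGraph V} {L : Set V}
    (hL : ∀ a b, G.Adj a b → (a ∈ L ↔ b ∉ L)) {C : Finset V}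
    (hC : ∀ a b, G.Adj a b → a ∈ C ∨ b ∈ C) : matchingNumber G ≤ C.card := by
  classical
  obtain ⟨K, hK, hu, hn⟩ := exists_maximum_matching G
  have hL' : ∀ a b, K.Adj a b → (a ∈ L ↔ b ∉ L) := fun a b h => hL a b (hK h)
  obtain ⟨t, ht, -⟩ := exists_injective_to_cover hL' hu (fun a b h => hC a b (hK h))
  rw [← hn, ncard_edgeSet_eq_card_pairs hL', ← Fintype.card_coe]
  exact Fintype.card_le_of_injective t ht

/-- **König's theorem**: a bipartite graph has a vertex cover of the size of a maximum matching. -/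
theorem exists_cover_card_eq_matchingNumber {V : Type*} [Fintype V] {G : SimpleGraph V}
    {L : Set V} (hL : ∀ a b, G.Adj a b → (a ∈ L ↔ b ∉ L)) :
    ∃ C : Finset V, (∀ a b, G.Adj a b → a ∈ C ∨ b ∈ C) ∧ C.card = matchingNumber G := by
  classical
  obtain ⟨C, hC, hmin⟩ := Finset.exists_min_image
    (Finset.univ.filter fun C : Finset V => ∀ a b, G.Adj a b → a ∈ C ∨ b ∈ C) Finset.card
    ⟨Finset.univ, by simp⟩
  simp only [Finset.mem_filter, Finset.mem_univ, true_and] at hC hmin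
  refine ⟨C, hC, le_antisymm ?_ (matchingNumber_le_card_cover hL hC)⟩
  let N : V → Finset V := fun c => Finset.univ.filter fun v => G.Adj c v ∧ v ∉ C
  -- Exchange argument: if `S ⊆ C` lies on one side (`b` says which), replacing `S` in `C` by its
  -- neighbours outside `C` leaves a cover, so minimality of `C` gives the inequality.
  have side : ∀ (b : Prop) (S : Finset V), S ⊆ C → (∀ s ∈ S, (s ∈ L ↔ b)) →
      S.card ≤ (S.biUnion N).card := by
    intro b S hSC hS
    have hcov := hmin ((C \ S) ∪ S.biUnion N) ?_
    · have h1 := Finset.card_union_le (C \ S) (S.biUnion N)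
      have h2 := Finset.card_sdiff_add_card_eq_card hSC
      omega
    · have key : ∀ u w, G.Adj u w → u ∈ C → u ∈ (C \ S) ∪ S.biUnion N ∨
          w ∈ (C \ S) ∪ S.biUnion N := by
        intro u w huw hu
        by_cases huS : u ∈ S
        · right
          by_cases hw : w ∈ C
          · refine Finset.mem_union_left _ (Finset.mem_sdiff.2 ⟨hw, fun hwS => ?_⟩)
            have h1 := hS _ huS
            have h2 := hS _ hwS
            have h3 := hL _ _ huw
            tauto
          · exact Finset.mem_union_right _ (Finset.mem_biUnion.2 ⟨u, huS, by simp [N, huw, hw]⟩)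
        · exact Or.inl (Finset.mem_union_left _ (Finset.mem_sdiff.2 ⟨hu, huS⟩))
      intro u w huw
      rcases hC u w huw with h | h
      · exact key u w huw h
      · exact (key w u huw.symm h).symm
  -- Hall's condition: split `S` by sides; the two neighbourhoods lie on opposite sides, so they are
  -- disjoint.
  have hall : ∀ S : Finset C, S.card ≤ (S.biUnion fun c => N c).card := by
    intro S
    set T : Finset V := S.map (Function.Embedding.subtype _) with hT
    have hTC : T ⊆ C := by
      intro v hv
      simp only [hT, Finset.mem_map] at hv
      obtain ⟨c, -, rfl⟩ := hv
      exact c.2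
    have h1 := side True (T.filter (· ∈ L)) ((Finset.filter_subset _ _).trans hTC) (by simp)
    have h2 := side False (T.filter (· ∉ L)) ((Finset.filter_subset _ _).trans hTC) (by simp)
    have h3 := Finset.card_filter_add_card_filter_not (s := T) (· ∈ L)
    have h4 : S.card = T.card := by simp [hT]
    have hdisj : Disjoint ((T.filter (· ∈ L)).biUnion N) ((T.filter (· ∉ L)).biUnion N) := by
      rw [Finset.disjoint_left]
      intro v hv hv'
      simp only [Finset.mem_biUnion, Finset.mem_filter, N, Finset.mem_univ, true_and] at hv hv'
      obtain ⟨a, ⟨-, ha⟩, hav, -⟩ := hv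
      obtain ⟨b, ⟨-, hb⟩, hbv, -⟩ := hv'
      exact hb ((hL _ _ hbv).2 ((hL _ _ hav).1 ha))
    have h5 := Finset.card_union_of_disjoint hdisj
    have h6 : ((T.filter (· ∈ L)).biUnion N) ∪ ((T.filter (· ∉ L)).biUnion N)
        ⊆ S.biUnion fun c => N c := by
      intro v hv
      simp only [Finset.mem_union, Finset.mem_biUnion, Finset.mem_filter, hT, Finset.mem_map] at hv ⊢
      rcases hv with ⟨a, ⟨⟨c, hc, rfl⟩, -⟩, h⟩ | ⟨a, ⟨⟨c, hc, rfl⟩, -⟩, h⟩ <;> exact ⟨c, hc, h⟩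
    have h7 := Finset.card_le_card h6
    omega
  obtain ⟨f, hf, hfN⟩ := (Finset.all_card_le_biUnion_card_iff_exists_injective _).1 hall
  have hfN' : ∀ c : C, G.Adj c (f c) ∧ f c ∉ C := fun c => by simpa [N] using hfN c
  -- The edges from `c` to `f c` form a matching of size `|C|`, since `f` is injective with values
  -- outside `C`.
  let K : SimpleGraph V :=
    { Adj := fun a b => (∃ c : C, (c : V) = a ∧ f c = b) ∨ (∃ c : C, (c : V) = b ∧ f c = a)
      symm := ⟨fun a b h => h.symm⟩
      loopless := ⟨fun a h => by
        rcases h with ⟨c, h1, h2⟩ | ⟨c, h1, h2⟩ <;> exact (hfN' c).1.ne (h1.trans h2.symm)⟩ }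
  have hKG : K ≤ G := by
    rintro a b (⟨c, rfl, rfl⟩ | ⟨c, rfl, rfl⟩)
    · exact (hfN' c).1
    · exact (hfN' c).1.symm
  have hKu : UniqueNeighbors K := by
    rintro a b d (⟨c, rfl, rfl⟩ | ⟨c, rfl, rfl⟩) (⟨c', h1, rfl⟩ | ⟨c', rfl, h2⟩)
    · rw [Subtype.ext h1]
    · exact absurd (h2 ▸ c.2) (hfN' c').2
    · exact absurd (h1 ▸ c'.2) (hfN' c).2
    · rw [hf h2]
  refine le_trans ?_ (ncard_le_matchingNumber hKG hKu)
  rw [← Fintype.card_coe, ← Nat.card_coe_set_eq, Nat.card_eq_fintype_card]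
  refine Fintype.card_le_of_injective (fun c : C => ⟨s((c : V), f c), Or.inl ⟨c, rfl, rfl⟩⟩) ?_
  intro c d h
  rcases Sym2.eq_iff.1 (congrArg Subtype.val h) with ⟨h, -⟩ | ⟨h, -⟩
  · exact Subtype.ext h
  · exact absurd (h ▸ c.2) (hfN' d).2

theorem eq_bot_of_matchingNumber_eq_zero {V : Type*} [Fintype V] {G : SimpleGraph V} {L : Set V}
    (hL : ∀ a b, G.Adj a b → (a ∈ L ↔ b ∉ L)) (h0 : matchingNumber G = 0) : G = ⊥ := by
  obtain ⟨C, hC, hcard⟩ := exists_cover_card_eq_matchingNumber hL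
  rw [h0, Finset.card_eq_zero] at hcard
  subst hcard
  ext a b
  simpa using fun h => hC a b h

/-- A maximum matching matches all vertices of a minimum vertex cover, along edges with only one
endpoint in the cover. -/
theorem matching_of_card_cover_eq {V : Type*} [Fintype V] {K : SimpleGraph V} {L : Set V}
    (hL : ∀ a b, K.Adj a b → (a ∈ L ↔ b ∉ L)) (hu : UniqueNeighbors K) {C : Finset V}
    (hC : ∀ a b, K.Adj a b → a ∈ C ∨ b ∈ C) (hcard : K.edgeSet.ncard = C.card) :
    (∀ c ∈ C, ∃ b, K.Adj c b) ∧ ∀ a b, K.Adj a b → ¬ (a ∈ C ∧ b ∈ C) := by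
  classical
  obtain ⟨t, ht, hend⟩ := exists_injective_to_cover hL hu hC
  -- Equal sizes leave no slack: every cover vertex is the chosen endpoint of some matching edge.
  have hbij : t.Bijective := by
    rw [Fintype.bijective_iff_injective_and_card]
    refine ⟨ht, ?_⟩
    rw [← ncard_edgeSet_eq_card_pairs hL, hcard, Fintype.card_coe]
  constructor
  · intro c hc
    obtain ⟨p, hp⟩ := hbij.2 ⟨c, hc⟩
    rcases hend p with h | h <;> rw [hp] at h <;> simp only at h
    · exact ⟨p.1.2, h ▸ p.2.2⟩
    · exact ⟨p.1.1, h ▸ p.2.2.symm⟩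
  · have key : ∀ a b, a ∈ L → K.Adj a b → ¬ (a ∈ C ∧ b ∈ C) := by
      rintro a b haL hab ⟨ha, hb⟩
      -- The matching edge that chooses `c` is incident to `c`, hence is the edge `ab`. With both
      -- ends in `C`, this edge would choose two endpoints.
      have uniq : ∀ c (hc : c ∈ C), c = a ∨ c = b → t ⟨(a, b), haL, hab⟩ = ⟨c, hc⟩ := by
        intro c hc hcab
        obtain ⟨⟨⟨a', b'⟩, h1, h2⟩, hp⟩ := hbij.2 ⟨c, hc⟩
        rw [← hp]
        have h := hend ⟨⟨a', b'⟩, h1, h2⟩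
        rw [hp] at h
        simp only at h h1 h2
        have e1 := (hL _ _ hab).1 haL
        have e2 := (hL _ _ h2).1 h1
        congr 2
        rcases hcab with rfl | rfl <;> rcases h with rfl | rfl
        · rw [hu hab h2]
        · exact absurd haL e2
        · exact absurd h1 e1
        · rw [hu hab.symm h2.symm]
      have h := (uniq a ha (Or.inl rfl)).symm.trans (uniq b hb (Or.inr rfl))
      exact hab.ne (congrArg Subtype.val h)
    intro a b hab h
    by_cases ha : a ∈ L
    · exact key a b ha hab h
    · refine key b a ?_ hab.symm h.symm
      by_contra hb
      exact ha ((hL _ _ hab).2 hb)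

theorem exists_side_of_isBipartite {V : Type*} {G : SimpleGraph V} (h : G.IsBipartite) :
    ∃ L : Set V, ∀ a b, G.Adj a b → (a ∈ L ↔ b ∉ L) := by
  obtain ⟨c⟩ := h
  refine ⟨{v | c v = 0}, fun a b hab => ?_⟩
  have := c.valid hab
  simp only [Set.mem_ofPred_eq]
  omega

/-! ### From an EDCS to a feasible solution -/

open scoped Classical in
/-- Counting the edges of `K` with an endpoint of profile `v` by their endpoints. -/
theorem card_pairs_touching {V α : Type*} [Fintype V] {J K : SimpleGraph V} {L : Set V}
    (hL : ∀ a b, J.Adj a b → (a ∈ L ↔ b ∉ L)) (hKJ : K ≤ J) (f : V → α) (v : α)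
    (hside : ∀ u w, f u = v → f w = v → (u ∈ L ↔ w ∈ L)) (d : ℕ)
    (hd : ∀ u, f u = v → (Finset.univ.filter (K.Adj u)).card = d) :
    (Finset.univ.filter fun p : {p : V × V // p.1 ∈ L ∧ J.Adj p.1 p.2} =>
      K.Adj p.1.1 p.1.2 ∧ (f p.1.1 = v ∨ f p.1.2 = v)).card =
      d * (Finset.univ.filter fun u => f u = v).card := by
  -- The endpoint of profile `v`. It is unique, since by `hside` all vertices of profile `v` are on
  -- one side; its fibres have size `d`.
  let t : {p : V × V // p.1 ∈ L ∧ J.Adj p.1 p.2} → V :=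
    fun p => if f p.1.1 = v then p.1.1 else p.1.2
  rw [Finset.card_eq_sum_card_fiberwise (f := t) (t := Finset.univ.filter fun u => f u = v),
    Finset.sum_const_nat (m := d), mul_comm]
  · intro u hu
    simp only [Finset.mem_filter, Finset.mem_univ, true_and] at hu
    rw [← hd u hu]
    symm
    have hmem : ∀ w, w ∈ Finset.univ.filter (K.Adj u) → (if u ∈ L then (u, w) else (w, u)).1 ∈ L ∧
        J.Adj (if u ∈ L then (u, w) else (w, u)).1 (if u ∈ L then (u, w) else (w, u)).2 := by
      intro w hw
      simp only [Finset.mem_filter, Finset.mem_univ, true_and] at hw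
      split_ifs with h
      · exact ⟨h, hKJ hw⟩
      · exact ⟨not_not.1 fun h' => h ((hL _ _ (hKJ hw)).2 h'), (hKJ hw).symm⟩
    refine Finset.card_bij (fun w hw => ⟨if u ∈ L then (u, w) else (w, u), hmem w hw⟩) ?_ ?_ ?_
    · intro w hw
      simp only [Finset.mem_filter, Finset.mem_univ, true_and] at hw
      have h1 := hL _ _ (hKJ hw)
      by_cases h : u ∈ L
      · simp [h, t, hu, hw]
      · have hw' : f w ≠ v := fun e => h ((hside _ _ hu e).2 (not_not.1 fun h' => h (h1.2 h')))
        simp [h, t, hu, hw.symm, hw']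
    · intro w hw w' hw' e
      have e := congrArg Subtype.val e
      simp only at e
      split_ifs at e <;> simpa using e
    · rintro ⟨⟨a, b⟩, ha, hab⟩ hp
      simp only [Finset.mem_filter, Finset.mem_univ, true_and, t] at hp ha hab
      obtain ⟨⟨hK, hv⟩, ht⟩ := hp
      have hb := (hL _ _ hab).1 ha
      split_ifs at ht with h
      · subst ht
        exact ⟨b, by simpa using hK, by simp [ha]⟩
      · subst ht
        exact ⟨a, by simpa using hK.symm, by simp [hb]⟩
  · intro p hp
    simp only [Finset.coe_filter, Finset.mem_univ, true_and, Set.mem_ofPred_eq, t] at hp ⊢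
    split_ifs with h
    · exact h
    · exact hp.2.resolve_left h

open scoped Classical in
/-- A bipartite graph and an EDCS with at least one edge give a feasible solution of the linear
program whose objective is the ratio of the matching numbers. -/
theorem IsEDCS.exists_lpFeasible {V : Type*} [Fintype V] {G H : SimpleGraph V}
    [DecidableRel H.Adj] {β βm : ℕ} (hβ : 0 < β) (hG : G.IsBipartite) (hE : IsEDCS β βm G H)
    (hpos : 0 < matchingNumber H) :
    ∃ (x : VP β → ℝ) (y : EP β βm → ℝ), LPFeasible β βm x y ∧
      lpObjective β βm y = (matchingNumber G : ℝ) / matchingNumber H := by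
  obtain ⟨L, hL⟩ := exists_side_of_isBipartite hG
  have hLH : ∀ a b, H.Adj a b → (a ∈ L ↔ b ∉ L) := fun a b h => hL a b (hE.le h)
  obtain ⟨C, hC, hCcard⟩ := exists_cover_card_eq_matchingNumber hLH
  obtain ⟨M, hMH, hMu, hMn⟩ := exists_maximum_matching H
  obtain ⟨S, hSG, hSu, hSn⟩ := exists_maximum_matching G
  have hLM : ∀ a b, M.Adj a b → (a ∈ L ↔ b ∉ L) := fun a b h => hLH a b (hMH h)
  have hLS : ∀ a b, S.Adj a b → (a ∈ L ↔ b ∉ L) := fun a b h => hL a b (hSG h)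
  obtain ⟨hCM, hMC⟩ := matching_of_card_cover_eq hLM hMu (fun a b h => hC a b (hMH h))
    (hMn.trans hCcard.symm)
  have hdegpos : ∀ a b, H.Adj a b → 0 < H.degree a := fun a b h =>
    (H.degree_pos_iff_exists_adj a).2 ⟨b, h⟩
  -- A neighbour in `H` has degree at least 1, and the two degrees sum to at most `β`.
  have hdeg : ∀ u, H.degree u < β := by
    intro u
    by_cases h : ∃ w, H.Adj u w
    · obtain ⟨w, hw⟩ := h
      have h1 := hE.deg_add_le u w hw
      have h2 := hdegpos w u hw.symm
      omega
    · have : ¬ 0 < H.degree u := fun h' => h ((H.degree_pos_iff_exists_adj u).1 h')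
      omega
  -- Membership in the minimum cover `C` fixes the positions: `C` consists of `L \ A` and `N(A)`.
  obtain ⟨prof, hpos', hdeg', hinM, hinS⟩ : ∃ prof : V → VP β,
      (∀ u, (prof u).1.pos = if u ∈ L then (if u ∈ C then Pos.LdiffA else Pos.A)
          else (if u ∈ C then Pos.NA else Pos.RdiffNA)) ∧
      (∀ u, ((prof u).1.deg : ℕ) = H.degree u) ∧
      (∀ u, (prof u).1.inM = true ↔ ∃ w, M.Adj u w) ∧
      (∀ u, (prof u).1.inMstar = true ↔ ∃ w, S.Adj u w) := by
    refine ⟨fun u =>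
      ⟨{ pos := if u ∈ L then (if u ∈ C then Pos.LdiffA else Pos.A)
            else (if u ∈ C then Pos.NA else Pos.RdiffNA)
         deg := ⟨H.degree u, hdeg u⟩
         inM := decide (∃ w, M.Adj u w)
         inMstar := decide (∃ w, S.Adj u w) }, ?_, ?_⟩, fun u => rfl, fun u => rfl,
      fun u => decide_eq_true_iff, fun u => decide_eq_true_iff⟩
    · intro h
      have hu : u ∈ C := by
        by_contra hu
        by_cases huL : u ∈ L <;> simp [hu, huL] at h
      exact decide_eq_true (hCM u hu)
    · intro h
      refine decide_eq_false ?_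
      rintro ⟨w, hw⟩
      exact (hdegpos u w (hMH hw)).ne' h
  have hposL : ∀ u, u ∈ L → (prof u).1.pos.InL := by
    intro u hu
    by_cases h : u ∈ C <;> simp [hpos', hu, h, Pos.InL]
  have hposR : ∀ u, u ∉ L → (prof u).1.pos.InR := by
    intro u hu
    by_cases h : u ∈ C <;> simp [hpos', hu, h, Pos.InR]
  have hposLA : ∀ u, u ∈ L → ((prof u).1.pos = Pos.LdiffA ↔ u ∈ C) := by
    intro u hu
    by_cases h : u ∈ C <;> simp [hpos', hu, h]
  have hposNA : ∀ u, u ∉ L → ((prof u).1.pos = Pos.NA ↔ u ∈ C) := by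
    intro u hu
    by_cases h : u ∈ C <;> simp [hpos', hu, h]
  have hnot : ∀ p : Pos, p.InL → ¬ p.InR := by
    intro p
    cases p <;> simp [Pos.InL, Pos.InR]
  have hside : ∀ v u w, prof u = v → prof w = v → (u ∈ L ↔ w ∈ L) := by
    intro v u w hu hw
    have h := hu.trans hw.symm
    constructor
    · intro huL
      by_contra hwL
      exact hnot _ (hposL u huL) (h ▸ hposR w hwL)
    · intro hwL
      by_contra huL
      exact hnot _ (hposL w hwL) (h ▸ hposR u huL)
  -- Only edges of `H ∪ M*` have a profile.
  let J : SimpleGraph V := H ⊔ S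
  have hLJ : ∀ a b, J.Adj a b → (a ∈ L ↔ b ∉ L) := fun a b h => h.elim (hLH a b) (hLS a b)
  let P := {p : V × V // p.1 ∈ L ∧ J.Adj p.1 p.2}
  obtain ⟨ep, hleft, hright, hepH, hepM, hepS⟩ : ∃ ep : P → EP β βm,
      (∀ p, (ep p).1.left = prof p.1.1) ∧ (∀ p, (ep p).1.right = prof p.1.2) ∧
      (∀ p, (ep p).1.inH = true ↔ H.Adj p.1.1 p.1.2) ∧
      (∀ p, (ep p).1.inM = true ↔ M.Adj p.1.1 p.1.2) ∧
      (∀ p, (ep p).1.inMstar = true ↔ S.Adj p.1.1 p.1.2) := by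
    refine ⟨fun p =>
      ⟨{ left := prof p.1.1
         right := prof p.1.2
         inH := decide (H.Adj p.1.1 p.1.2)
         inM := decide (M.Adj p.1.1 p.1.2)
         inMstar := decide (S.Adj p.1.1 p.1.2) }, ?_⟩, fun p => rfl, fun p => rfl,
      fun p => decide_eq_true_iff, fun p => decide_eq_true_iff, fun p => decide_eq_true_iff⟩
    obtain ⟨⟨a, b⟩, ha, hab⟩ := p
    simp only at ha hab
    have hb := (hLJ _ _ hab).1 ha
    simp only [EdgeProfile.Valid, decide_eq_true_eq, decide_eq_false_iff_not, hdeg', hinM, hinS]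
    refine ⟨⟨hposL a ha, hposR b hb⟩, fun h => ⟨(hdegpos _ _ h).ne', (hdegpos _ _ h.symm).ne'⟩,
      fun h => ⟨⟨_, h⟩, ⟨_, h.symm⟩⟩, fun h => ⟨⟨_, h⟩, ⟨_, h.symm⟩⟩,
      fun h => hMH h, hab, fun h => hE.deg_add_le _ _ h,
      fun h => hE.le_deg_add _ _ (hab.elim (fun h' => absurd h' h) fun h' => hSG h') h,
      fun h => ?_, fun h => ?_⟩
    · rcases hC _ _ h with h' | h' <;> simp [hpos', ha, hb, h']
    · have h1 := hMC _ _ h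
      have h2 := hC _ _ (hMH h)
      rw [hposNA b hb, hposLA a ha]
      by_cases haC : a ∈ C
      · exact Or.inr ⟨haC, fun hbC => h1 ⟨haC, hbC⟩⟩
      · exact Or.inl ⟨h2.resolve_left haC, haC⟩
  set k : ℝ := (matchingNumber H : ℝ) with hk
  have hk0 : 0 < k := Nat.cast_pos.2 hpos
  -- Profile counts divided by `μ(H) = |M|`, so that the edges of `M` have total weight 1.
  let x : VP β → ℝ := fun v => ((Finset.univ.filter fun u => prof u = v).card : ℝ) / k
  let y : EP β βm → ℝ := fun e => ((Finset.univ.filter fun p => ep p = e).card : ℝ) / k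
  have hsum : ∀ (Q : EP β βm → Prop) [DecidablePred Q], ∑ e with Q e, y e =
      ((Finset.univ.filter fun p => Q (ep p)).card : ℝ) / k := by
    intro Q _
    rw [← Finset.sum_div, ← Nat.cast_sum]
    congr 2
    rw [Finset.card_eq_sum_card_fiberwise (f := ep) (t := Finset.univ.filter Q)]
    · refine Finset.sum_congr rfl fun e he => ?_
      simp only [Finset.mem_filter, Finset.mem_univ, true_and] at he
      congr 1
      ext p
      simp only [Finset.mem_filter, Finset.mem_univ, true_and]
      exact ⟨fun h => ⟨h ▸ he, h⟩, fun h => h.2⟩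
    · intro p hp
      simpa using hp
  have htouch : ∀ (K : SimpleGraph V) (v : VP β) (d : ℕ), K ≤ J →
      (∀ u, prof u = v → (Finset.univ.filter (K.Adj u)).card = d) →
      ((Finset.univ.filter fun p : P => K.Adj p.1.1 p.1.2 ∧
        (prof p.1.1 = v ∨ prof p.1.2 = v)).card : ℝ) / k = d * x v := by
    intro K v d hKJ hd
    have h := card_pairs_touching hLJ hKJ prof v (hside v) d hd
    rw [mul_div_assoc', ← Nat.cast_mul]
    congr 2
    convert h
  have hone : ∀ (K : SimpleGraph V), UniqueNeighbors K → ∀ u, (∃ w, K.Adj u w) →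
      (Finset.univ.filter (K.Adj u)).card = 1 := by
    rintro K hK u ⟨w, hw⟩
    rw [Finset.card_eq_one]
    refine ⟨w, ?_⟩
    ext z
    simp only [Finset.mem_filter, Finset.mem_univ, true_and, Finset.mem_singleton]
    exact ⟨fun h => hK h hw, fun h => h ▸ hw⟩
  have hcount : ∀ (K : SimpleGraph V), K ≤ J → (Finset.univ.filter fun p : P =>
      K.Adj p.1.1 p.1.2).card = K.edgeSet.ncard := by
    intro K hKJ
    rw [ncard_edgeSet_eq_card_pairs (L := L) (fun a b h => hLJ a b (hKJ h)), ← Fintype.card_subtype]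
    refine Fintype.card_congr
      { toFun := fun p => ⟨p.1.1, p.1.2.1, p.2⟩
        invFun := fun p => ⟨⟨p.1, p.2.1, hKJ p.2.2⟩, p.2.2⟩
        left_inv := fun p => rfl
        right_inv := fun p => rfl }
  have hMJ : M ≤ J := hMH.trans le_sup_left
  refine ⟨x, y, ⟨fun v => ?_, fun v hv => ?_, fun v hv => ?_, ?_, fun e => ?_, fun v => ?_⟩, ?_⟩
  · rw [hsum, ← htouch H v v.1.deg le_sup_left]
    · congr! 4
      exact and_congr (hepH _) (by rw [EdgeProfile.Touches, hleft, hright])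
    · rintro u rfl
      rw [hdeg', ← SimpleGraph.card_neighborFinset_eq_degree]
      congr 1
      ext
      simp
  · rw [hsum, ← one_mul (x v), ← Nat.cast_one, ← htouch M v 1 hMJ]
    · congr! 4
      exact and_congr (hepM _) (by rw [EdgeProfile.Touches, hleft, hright])
    · rintro u rfl
      exact hone M hMu u ((hinM u).1 hv)
  · rw [hsum, ← one_mul (x v), ← Nat.cast_one, ← htouch S v 1 le_sup_right]
    · congr! 4
      exact and_congr (hepS _) (by rw [EdgeProfile.Touches, hleft, hright])
    · rintro u rfl
      exact hone S hSu u ((hinS u).1 hv)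
  · rw [hsum, ← div_self hk0.ne', hk, ← hMn, ← hcount M hMJ]
    congr! 4
    exact hepM _
  · positivity
  · positivity
  · rw [lpObjective, hsum, ← hSn, ← hcount S le_sup_right]
    congr! 4
    exact hepS _

/-! ### Boundedness and existence of an optimal solution -/

/-- The constraints of the linear program over an ordered semiring, with the right-hand side of the
normalization constraint as a parameter `N`. -/
structure HomFeasible (K : Type*) [Semiring K] [PartialOrder K] (β βm : ℕ) (x : VP β → K)
    (y : EP β βm → K) (N : K) : Prop where
  sum_H : ∀ v : VP β,
    ∑ e : EP β βm with e.1.inH = true ∧ e.1.Touches v, y e = ((v.1.deg : ℕ) : K) * x v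
  sum_M : ∀ v : VP β, v.1.inM = true →
    ∑ e : EP β βm with e.1.inM = true ∧ e.1.Touches v, y e = x v
  sum_Mstar : ∀ v : VP β, v.1.inMstar = true →
    ∑ e : EP β βm with e.1.inMstar = true ∧ e.1.Touches v, y e = x v
  sum_M_eq : ∑ e : EP β βm with e.1.inM = true, y e = N
  edge_nonneg : ∀ e, 0 ≤ y e
  vertex_nonneg : ∀ v, 0 ≤ x v

variable {β βm : ℕ}

theorem HomFeasible.lpFeasible_div {x : VP β → ℝ} {y : EP β βm → ℝ} {N : ℝ}
    (h : HomFeasible ℝ β βm x y N) (hN : 0 < N) :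
    LPFeasible β βm (fun v => x v / N) (fun e => y e / N) where
  sum_H v := by rw [← Finset.sum_div, h.sum_H, mul_div_assoc]
  sum_M v hv := by rw [← Finset.sum_div, h.sum_M v hv]
  sum_Mstar v hv := by rw [← Finset.sum_div, h.sum_Mstar v hv]
  sum_M_eq_one := by rw [← Finset.sum_div, h.sum_M_eq, div_self hN.ne']
  edge_nonneg e := div_nonneg (h.edge_nonneg e) hN.le
  vertex_nonneg v := div_nonneg (h.vertex_nonneg v) hN.le

/-- An edge of `H` has an endpoint in `N(A)` or `L \ A`. That endpoint is matched in `M`, so its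
variable is at most 1 and the edge has weight at most `β`. An edge outside `H` is in `M*` and, as `1
≤ βm`, has an endpoint of nonzero degree, whose variable is bounded by the weight of the edges of
`H` there. -/
theorem LPFeasible.edge_le {x : VP β → ℝ} {y : EP β βm → ℝ} (hβm : 1 ≤ βm)
    (h : LPFeasible β βm x y) (e : EP β βm) :
    y e ≤ Fintype.card (EP β βm) * β := by
  have hxM : ∀ v : VP β, v.1.inM = true → x v ≤ 1 := by
    intro v hv
    rw [← h.sum_M v hv, ← h.sum_M_eq_one]
    exact Finset.sum_le_sum_of_subset_of_nonneg
      (fun e he => by simp only [Finset.mem_filter] at he ⊢; tauto) fun e _ _ => h.edge_nonneg e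
  have hH : ∀ e : EP β βm, e.1.inH = true → y e ≤ β := by
    intro e he
    have key : ∀ v : VP β, e.1.Touches v → v.1.inM = true → y e ≤ β := by
      intro v hev hv
      calc y e ≤ ∑ e : EP β βm with e.1.inH = true ∧ e.1.Touches v, y e :=
            Finset.single_le_sum (fun e _ => h.edge_nonneg e) (by simp [he, hev])
        _ = ((v.1.deg : ℕ) : ℝ) * x v := h.sum_H v
        _ ≤ β * 1 := by
            gcongr
            · exact h.vertex_nonneg v
            · exact v.1.deg.2.le
            · exact hxM v hv
        _ = β := mul_one _
    have hA := e.2.2.2.2.2.2.2.2.2.1 he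
    rcases e.2.1.1 with hl | hl
    · rcases e.2.1.2 with hr | hr
      · exact key _ (Or.inr rfl) (e.1.right.2.1 (Or.inl hr))
      · exact absurd ⟨hl, hr⟩ hA
    · exact key _ (Or.inl rfl) (e.1.left.2.1 (Or.inr hl))
  have hcard : (1 : ℝ) ≤ Fintype.card (EP β βm) := by
    exact_mod_cast Fintype.card_pos_iff.2 ⟨e⟩
  by_cases he : e.1.inH = true
  · refine (hH e he).trans (le_mul_of_one_le_left (Nat.cast_nonneg _) hcard)
  · have hS : e.1.inMstar = true := e.2.2.2.2.2.2.1.resolve_left he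
    have hx : ∀ v : VP β, e.1.Touches v → v.1.inMstar = true → (v.1.deg : ℕ) ≠ 0 →
        y e ≤ Fintype.card (EP β βm) * β := by
      intro v hev hv hd
      calc y e ≤ ∑ e : EP β βm with e.1.inMstar = true ∧ e.1.Touches v, y e :=
            Finset.single_le_sum (fun e _ => h.edge_nonneg e) (by simp [hS, hev])
        _ = x v := h.sum_Mstar v hv
        _ ≤ ((v.1.deg : ℕ) : ℝ) * x v := le_mul_of_one_le_left (h.vertex_nonneg v)
            (by exact_mod_cast Nat.one_le_iff_ne_zero.2 hd)
        _ = ∑ e : EP β βm with e.1.inH = true ∧ e.1.Touches v, y e := (h.sum_H v).symm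
        _ ≤ ∑ e : EP β βm with e.1.inH = true ∧ e.1.Touches v, (β : ℝ) :=
            Finset.sum_le_sum fun e he => hH e (Finset.mem_filter.1 he).2.1
        _ ≤ Fintype.card (EP β βm) * β := by
            rw [Finset.sum_const, nsmul_eq_mul]
            gcongr
            exact Finset.card_le_univ _
    have hlr := e.2.2.2.2.1 hS
    have hd := e.2.2.2.2.2.2.2.2.1 (by simpa using he)
    by_cases h0 : (e.1.left.1.deg : ℕ) = 0
    · exact hx _ (Or.inr rfl) hlr.2 (by omega)
    · exact hx _ (Or.inl rfl) hlr.1 h0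

/-- Without changing the edge variables, the vertex variables of a feasible solution can be made
bounded. -/
theorem LPFeasible.exists_vertex_le {x : VP β → ℝ} {y : EP β βm → ℝ} (hβm : 1 ≤ βm)
    (h : LPFeasible β βm x y) :
    ∃ x', LPFeasible β βm x' y ∧
      ∀ v, x' v ≤ Fintype.card (EP β βm) * (Fintype.card (EP β βm) * β) := by
  -- Profiles of degree 0 outside `M*` are also outside `M`. Their variables are constrained only by
  -- nonnegativity and can be set to 0; any other variable is at most the weight of the edges of `H`
  -- or `M*` at it.
  refine ⟨fun v => if (v.1.deg : ℕ) = 0 ∧ v.1.inMstar = false then 0 else x v,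
    ⟨fun v => ?_, fun v hv => ?_, fun v hv => ?_, h.sum_M_eq_one, h.edge_nonneg, fun v => ?_⟩,
    fun v => ?_⟩
  · rw [h.sum_H]
    split_ifs with hc
    · simp [hc.1]
    · rfl
  · rw [h.sum_M v hv, if_neg]
    rintro ⟨h0, -⟩
    simp [v.2.2 h0] at hv
  · rw [h.sum_Mstar v hv, if_neg]
    simp [hv]
  · split_ifs
    · exact le_rfl
    · exact h.vertex_nonneg v
  · have hb : ∀ Q : EP β βm → Prop, ∀ [DecidablePred Q], ∑ e with Q e, y e ≤
        Fintype.card (EP β βm) * (Fintype.card (EP β βm) * β) := by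
      intro Q _
      calc ∑ e with Q e, y e ≤ ∑ e with Q e, (Fintype.card (EP β βm) * β : ℝ) :=
            Finset.sum_le_sum fun e _ => h.edge_le hβm e
        _ ≤ _ := by
            rw [Finset.sum_const, nsmul_eq_mul]
            gcongr
            exact Finset.card_le_univ _
    dsimp only
    split_ifs with hc
    · positivity
    · by_cases hv : v.1.inMstar = true
      · rw [← h.sum_Mstar v hv]
        exact hb _
      · have hd : (v.1.deg : ℕ) ≠ 0 := fun h0 => hc ⟨h0, by simpa using hv⟩
        refine le_trans ?_ (hb fun e => e.1.inH = true ∧ e.1.Touches v)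
        rw [h.sum_H]
        exact le_mul_of_one_le_left (h.vertex_nonneg v)
          (by exact_mod_cast Nat.one_le_iff_ne_zero.2 hd)

/-- The feasible set is closed but may be unbounded in free vertex variables. The objective depends
on `y` alone, so maximizing over the compact part `F` suffices. -/
theorem exists_isLPOptimalValue (hβm : 1 ≤ βm)
    (hne : ∃ (x : VP β → ℝ) (y : EP β βm → ℝ), LPFeasible β βm x y) :
    ∃ r, IsLPOptimalValue β βm r := by
  set B : ℝ := Fintype.card (EP β βm) * β
  set B' : ℝ := Fintype.card (EP β βm) * B
  let F : Set ((VP β → ℝ) × (EP β βm → ℝ)) :=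
    {p | LPFeasible β βm p.1 p.2} ∩
      (Set.univ.pi fun _ => Set.Icc 0 B') ×ˢ (Set.univ.pi fun _ => Set.Icc 0 B)
  have hclosed : IsClosed {p : (VP β → ℝ) × (EP β βm → ℝ) | LPFeasible β βm p.1 p.2} := by
    have heq : {p : (VP β → ℝ) × (EP β βm → ℝ) | LPFeasible β βm p.1 p.2} =
      (⋂ v : VP β, {p | ∑ e : EP β βm with e.1.inH = true ∧ e.1.Touches v, p.2 e =
        ((v.1.deg : ℕ) : ℝ) * p.1 v}) ∩
      (⋂ v : VP β, ⋂ _ : v.1.inM = true,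
        {p | ∑ e : EP β βm with e.1.inM = true ∧ e.1.Touches v, p.2 e = p.1 v}) ∩
      (⋂ v : VP β, ⋂ _ : v.1.inMstar = true,
        {p | ∑ e : EP β βm with e.1.inMstar = true ∧ e.1.Touches v, p.2 e = p.1 v}) ∩
      {p | ∑ e : EP β βm with e.1.inM = true, p.2 e = 1} ∩
      (⋂ e : EP β βm, {p | 0 ≤ p.2 e}) ∩ (⋂ v : VP β, {p | 0 ≤ p.1 v}) := by
      ext p
      simp only [Set.mem_inter_iff, Set.mem_iInter, Set.mem_ofPred_eq]
      exact ⟨fun h => ⟨⟨⟨⟨⟨h.1, h.2⟩, h.3⟩, h.4⟩, h.5⟩, h.6⟩,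
        fun ⟨⟨⟨⟨⟨h1, h2⟩, h3⟩, h4⟩, h5⟩, h6⟩ => ⟨h1, h2, h3, h4, h5, h6⟩⟩
    rw [heq]
    refine ((((IsClosed.inter ?_ ?_).inter ?_).inter ?_).inter ?_).inter ?_
    · exact isClosed_iInter fun v => isClosed_eq (by fun_prop) (by fun_prop)
    · exact isClosed_iInter fun v => isClosed_iInter fun _ => isClosed_eq (by fun_prop) (by fun_prop)
    · exact isClosed_iInter fun v => isClosed_iInter fun _ => isClosed_eq (by fun_prop) (by fun_prop)
    · exact isClosed_eq (by fun_prop) (by fun_prop)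
    · exact isClosed_iInter fun v => isClosed_le (by fun_prop) (by fun_prop)
    · exact isClosed_iInter fun v => isClosed_le (by fun_prop) (by fun_prop)
  have hcompact : IsCompact F := IsCompact.inter_left
    ((isCompact_univ_pi fun _ => isCompact_Icc).prod (isCompact_univ_pi fun _ => isCompact_Icc))
    hclosed
  have hbounded : ∀ x y, LPFeasible β βm x y → ∃ x', (x', y) ∈ F := by
    intro x y h
    obtain ⟨x', hx', hle⟩ := h.exists_vertex_le hβm
    exact ⟨x', hx', fun v _ => ⟨hx'.vertex_nonneg v, hle v⟩,
      fun e _ => ⟨hx'.edge_nonneg e, hx'.edge_le hβm e⟩⟩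
  have hcont : Continuous fun p : (VP β → ℝ) × (EP β βm → ℝ) => lpObjective β βm p.2 := by
    unfold lpObjective
    fun_prop
  obtain ⟨x, y, hxy⟩ := hne
  obtain ⟨x', hx'⟩ := hbounded x y hxy
  obtain ⟨p, hp, hmax⟩ := hcompact.exists_isMaxOn ⟨_, hx'⟩ hcont.continuousOn
  refine ⟨lpObjective β βm p.2, ⟨p.1, p.2, hp.1, rfl⟩, ?_⟩
  rintro t ⟨a, b, hab, rfl⟩
  obtain ⟨a', ha'⟩ := hbounded a b hab
  exact hmax ha'

/-! ### Passing to an integral optimal solution -/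

open Filter Topology in
/-- `ℚ`-linear maps from the reals to the rationals approximate the identity on finite sets. -/
theorem exists_linearMap_rat_approx (s : Finset ℝ) (hs : ∀ a ∈ s, 0 ≤ a) :
    ∃ φ : ℝ →ₗ[ℚ] ℚ, ∀ a ∈ s, a / 2 ≤ φ a ∧ (φ a : ℝ) ≤ 3 * a / 2 := by
  -- Send each vector of a Hamel basis to rationals converging to it. A real number is a finite
  -- rational combination of basis vectors, so its images converge to it.
  let b := Module.Basis.ofVectorSpace ℚ ℝ
  have hq : ∀ z : ℝ, ∃ q : ℕ → ℚ, Tendsto (fun n => (q n : ℝ)) atTop (𝓝 z) := by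
    intro z
    have hex : ∀ n : ℕ, ∃ q : ℚ, z < q ∧ (q : ℝ) < z + 1 / ((n : ℝ) + 1) := fun n =>
      exists_rat_btwn (lt_add_of_pos_right _ Nat.one_div_pos_of_nat)
    choose q h1 h2 using hex
    refine ⟨q, tendsto_of_tendsto_of_tendsto_of_le_of_le tendsto_const_nhds ?_
      (fun n => (h1 n).le) fun n => (h2 n).le⟩
    simpa using tendsto_const_nhds.add (tendsto_one_div_add_atTop_nhds_zero_nat (𝕜 := ℝ))
  choose q hq using fun i => hq (b i)
  let φ : ℕ → ℝ →ₗ[ℚ] ℚ := fun n => b.constr ℚ fun i => q i n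
  have hφ : ∀ a : ℝ, Tendsto (fun n => (φ n a : ℝ)) atTop (𝓝 a) := by
    intro a
    have h1 : ∀ n, (φ n a : ℝ) = ∑ i ∈ (b.repr a).support, (b.repr a i : ℝ) * q i n := by
      intro n
      simp only [φ, Module.Basis.constr_apply, Finsupp.sum, smul_eq_mul]
      push_cast
      rfl
    have h2 : a = ∑ i ∈ (b.repr a).support, (b.repr a i : ℝ) * b i := by
      conv_lhs => rw [← b.linearCombination_repr a]
      simp only [Finsupp.linearCombination_apply, Finsupp.sum, Rat.smul_def]
    simp only [h1]
    have h3 := tendsto_finsetSum (b.repr a).support fun i _ => (hq i).const_mul (b.repr a i : ℝ)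
    rwa [← h2] at h3
  have hev : ∀ a ∈ s, ∀ᶠ n in atTop, a / 2 ≤ φ n a ∧ (φ n a : ℝ) ≤ 3 * a / 2 := by
    intro a ha
    -- Zero is mapped to zero exactly, by linearity; approximation alone would not give the two
    -- bounds there.
    rcases (hs a ha).eq_or_lt with h0 | h0
    · simp [← h0]
    · filter_upwards [(hφ a).eventually_const_lt (u := a / 2) (by linarith),
        (hφ a).eventually_lt_const (u := 3 * a / 2) (by linarith)] with n h1 h2
      exact ⟨h1.le, h2.le⟩
  obtain ⟨n, hn⟩ := ((Finset.eventually_all s).2 hev).exists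
  exact ⟨φ n, hn⟩

/-- The linear program has an optimal solution that is, up to scaling, integral. -/
theorem IsLPOptimalValue.exists_nat {r : ℝ} (hr : IsLPOptimalValue β βm r) :
    ∃ (n : VP β → ℕ) (m : EP β βm → ℕ) (N : ℕ), 0 < N ∧ HomFeasible ℕ β βm n m N ∧
      ((∑ e : EP β βm with e.1.inMstar = true, m e : ℕ) : ℝ) = r * N := by
  obtain ⟨⟨x, y, hxy, hobj⟩, hub⟩ := hr
  have hle : ∀ (x' : VP β → ℝ) (y' : EP β βm → ℝ) (N : ℝ), 0 < N → HomFeasible ℝ β βm x' y' N →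
      ∑ e : EP β βm with e.1.inMstar = true, y' e ≤ r * N := by
    intro x' y' N hN h
    have := hub ⟨_, _, h.lpFeasible_div hN, rfl⟩
    rw [lpObjective, ← Finset.sum_div, div_le_iff₀ hN] at this
    exact this
  obtain ⟨φ, hφ⟩ := exists_linearMap_rat_approx
    (insert 1 (Finset.univ.image x ∪ Finset.univ.image y)) (by
      intro a ha
      simp only [Finset.mem_insert, Finset.mem_union, Finset.mem_image, Finset.mem_univ,
        true_and] at ha
      rcases ha with rfl | ⟨v, rfl⟩ | ⟨e, rfl⟩
      · exact zero_le_one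
      · exact hxy.vertex_nonneg v
      · exact hxy.edge_nonneg e)
  have h1 := hφ 1 (by simp)
  have hx := fun v => hφ (x v) (by simp)
  have hy := fun e => hφ (y e) (by simp)
  have hx0 := hxy.vertex_nonneg
  have hy0 := hxy.edge_nonneg
  have hnat : ∀ (k : ℕ) (a : ℝ), φ (k * a) = k * φ a := by
    intro k a
    rw [← nsmul_eq_mul, map_nsmul, nsmul_eq_mul]
  have hfeas : HomFeasible ℚ β βm (fun v => φ (x v)) (fun e => φ (y e)) (φ 1) :=
    { sum_H := fun v => by rw [← map_sum, hxy.sum_H, hnat]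
      sum_M := fun v hv => by rw [← map_sum, hxy.sum_M v hv]
      sum_Mstar := fun v hv => by rw [← map_sum, hxy.sum_Mstar v hv]
      sum_M_eq := by rw [← map_sum, hxy.sum_M_eq_one]
      edge_nonneg := fun e => by
        have := hy e
        have := hy0 e
        exact_mod_cast (show (0 : ℝ) ≤ φ (y e) by linarith)
      vertex_nonneg := fun v => by
        have := hx v
        have := hx0 v
        exact_mod_cast (show (0 : ℝ) ≤ φ (x v) by linarith) }
  have hobj' : ∑ e : EP β βm with e.1.inMstar = true, φ (y e) = φ r := by
    rw [← map_sum]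
    exact congrArg φ hobj
  -- Both `φ z` and `2 * z - φ z` satisfy the homogeneous constraints, as `z / 2 ≤ φ z ≤ 3 * z / 2`
  -- keeps them nonnegative. Their average is the optimal solution, so the two bounds from
  -- optimality force `φ r = r * φ 1`.
  have hup := hle (fun v => φ (x v)) (fun e => φ (y e)) (φ 1) (by linarith)
    { sum_H := fun v => by exact_mod_cast hfeas.sum_H v
      sum_M := fun v hv => by exact_mod_cast hfeas.sum_M v hv
      sum_Mstar := fun v hv => by exact_mod_cast hfeas.sum_Mstar v hv
      sum_M_eq := by exact_mod_cast hfeas.sum_M_eq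
      edge_nonneg := fun e => by exact_mod_cast hfeas.edge_nonneg e
      vertex_nonneg := fun v => by exact_mod_cast hfeas.vertex_nonneg v }
  have hdown := hle (fun v => 2 * x v - φ (x v)) (fun e => 2 * y e - φ (y e)) (2 - φ 1)
    (by linarith)
    { sum_H := fun v => by
        rw [Finset.sum_sub_distrib, ← Finset.mul_sum, hxy.sum_H, ← Rat.cast_sum, hfeas.sum_H]
        push_cast
        ring
      sum_M := fun v hv => by
        rw [Finset.sum_sub_distrib, ← Finset.mul_sum, hxy.sum_M v hv, ← Rat.cast_sum,
          hfeas.sum_M v hv]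
      sum_Mstar := fun v hv => by
        rw [Finset.sum_sub_distrib, ← Finset.mul_sum, hxy.sum_Mstar v hv, ← Rat.cast_sum,
          hfeas.sum_Mstar v hv]
      sum_M_eq := by
        rw [Finset.sum_sub_distrib, ← Finset.mul_sum, hxy.sum_M_eq_one, ← Rat.cast_sum,
          hfeas.sum_M_eq, mul_one]
      edge_nonneg := fun e => by
        have := hy e
        have := hy0 e
        linarith
      vertex_nonneg := fun v => by
        have := hx v
        have := hx0 v
        linarith }
  rw [← Rat.cast_sum, hobj'] at hup
  rw [Finset.sum_sub_distrib, ← Finset.mul_sum, ← Rat.cast_sum, hobj',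
    show ∑ e : EP β βm with e.1.inMstar = true, y e = r from hobj] at hdown
  have hratio : (φ r : ℝ) = r * φ 1 := by linarith
  -- A common denominator of all values, including the normalization `φ 1`.
  let D : ℕ := (φ 1).den * ((∏ v, (φ (x v)).den) * ∏ e, (φ (y e)).den)
  have hD : 0 < D := Nat.mul_pos (Rat.den_pos _) (Nat.mul_pos
    (Finset.prod_pos fun v _ => Rat.den_pos _) (Finset.prod_pos fun e _ => Rat.den_pos _))
  have hclear : ∀ q : ℚ, 0 ≤ q → q.den ∣ D → ∃ k : ℕ, (k : ℚ) = D * q := by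
    rintro q hq ⟨c, hc⟩
    refine ⟨c * q.num.toNat, ?_⟩
    have hnum : ((q.num.toNat : ℕ) : ℚ) = q.num := by
      exact_mod_cast Int.toNat_of_nonneg (Rat.num_nonneg.2 hq)
    rw [hc]
    push_cast
    rw [hnum]
    have := Rat.den_mul_eq_num q
    linear_combination (-(c : ℚ)) * this
  choose n hn using fun v => hclear (φ (x v)) (hfeas.vertex_nonneg v)
    (((Finset.dvd_prod_of_mem _ (Finset.mem_univ v)).mul_right _).mul_left _)
  choose m hm using fun e => hclear (φ (y e)) (hfeas.edge_nonneg e)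
    (((Finset.dvd_prod_of_mem (fun e => (φ (y e)).den) (Finset.mem_univ e)).mul_left _).mul_left _)
  have h1pos : (0 : ℝ) < φ 1 := by linarith
  obtain ⟨N, hN⟩ := hclear (φ 1) (by exact_mod_cast h1pos.le) (Dvd.intro _ rfl)
  refine ⟨n, m, N, ?_, ⟨fun v => ?_, fun v hv => ?_, fun v hv => ?_, ?_, fun _ => Nat.zero_le _,
    fun _ => Nat.zero_le _⟩, ?_⟩
  · have : (0 : ℚ) < N := by
      rw [hN]
      have : (0 : ℚ) < φ 1 := by exact_mod_cast h1pos
      positivity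
    exact_mod_cast this
  · have : ((∑ e : EP β βm with e.1.inH = true ∧ e.1.Touches v, m e : ℕ) : ℚ) =
        ((v.1.deg : ℕ) * n v : ℕ) := by
      push_cast
      simp only [hm, hn]
      rw [← Finset.mul_sum, hfeas.sum_H]
      ring
    exact_mod_cast this
  · have : ((∑ e : EP β βm with e.1.inM = true ∧ e.1.Touches v, m e : ℕ) : ℚ) = n v := by
      push_cast
      simp only [hm, hn]
      rw [← Finset.mul_sum, hfeas.sum_M v hv]
    exact_mod_cast this
  · have : ((∑ e : EP β βm with e.1.inMstar = true ∧ e.1.Touches v, m e : ℕ) : ℚ) = n v := by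
      push_cast
      simp only [hm, hn]
      rw [← Finset.mul_sum, hfeas.sum_Mstar v hv]
    exact_mod_cast this
  · have : ((∑ e : EP β βm with e.1.inM = true, m e : ℕ) : ℚ) = N := by
      push_cast
      simp only [hm, hN]
      rw [← Finset.mul_sum, hfeas.sum_M_eq]
    exact_mod_cast this
  · have h2 : ((∑ e : EP β βm with e.1.inMstar = true, m e : ℕ) : ℚ) = D * φ r := by
      push_cast
      simp only [hm]
      rw [← Finset.mul_sum, hobj']
    have h3 : ((∑ e : EP β βm with e.1.inMstar = true, m e : ℕ) : ℝ) = D * φ r := by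
      exact_mod_cast congrArg (Rat.cast : ℚ → ℝ) h2
    have h4 : (N : ℝ) = D * φ 1 := by exact_mod_cast congrArg (Rat.cast : ℚ → ℝ) hN
    rw [h3, h4, hratio]
    ring

/-! ### Distributing edge ends evenly among vertices -/

theorem natCard_subtype_eq {E : Type*} [Fintype E] (P : E → Prop) [DecidablePred P] :
    Nat.card {e // P e} = (Finset.univ.filter P).card := by
  rw [Nat.card_eq_fintype_card, Fintype.card_subtype]

theorem natCard_subtype_congr {E : Type*} {P Q : E → Prop} (h : ∀ e, P e ↔ Q e) :
    Nat.card {e // P e} = Nat.card {e // Q e} :=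
  Nat.card_congr (Equiv.subtypeEquivRight h)

theorem natCard_subtype_mono {E : Type*} [Finite E] {P Q : E → Prop} (h : ∀ e, P e → Q e) :
    Nat.card {e // P e} ≤ Nat.card {e // Q e} :=
  Nat.card_le_card_of_injective (Subtype.map id h) (Subtype.map_injective h Function.injective_id)

theorem natCard_subtype_split {E : Type*} [Finite E] (P Q : E → Prop) :
    Nat.card {e // P e} = Nat.card {e // P e ∧ Q e} + Nat.card {e // P e ∧ ¬ Q e} := by
  classical
  have := Fintype.ofFinite E
  simp only [natCard_subtype_eq]
  rw [← Finset.card_filter_add_card_filter_not (s := Finset.univ.filter P) Q,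
    Finset.filter_filter, Finset.filter_filter]

theorem sum_natCard_fiber {E U : Type*} [Finite E] [Fintype U] (P : E → Prop) (f : E → U) :
    ∑ u, Nat.card {e // P e ∧ f e = u} = Nat.card {e // P e} := by
  classical
  have := Fintype.ofFinite E
  simp only [natCard_subtype_eq]
  rw [Finset.card_eq_sum_card_fiberwise (f := f) (t := Finset.univ) (by simp)]
  simp only [Finset.filter_filter]

theorem exists_map_natCard_fiber_eq {E U : Type*} [Finite E] [Fintype U] [Nonempty U]
    (P : E → Prop) (r : U → ℕ) (h : ∑ u, r u = Nat.card {e // P e}) :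
    ∃ f : E → U, ∀ u, Nat.card {e // P e ∧ f e = u} = r u := by
  classical
  let g : {e // P e} ≃ Σ u, Fin (r u) :=
    (Finite.card_eq.1 (by rw [← h]; simp [Nat.card_eq_fintype_card])).some
  refine ⟨fun e => if he : P e then (g ⟨e, he⟩).1 else Classical.arbitrary U, fun u => ?_⟩
  rw [← Nat.card_fin (r u)]
  symm
  refine Nat.card_eq_of_bijective
    (fun i => ⟨(g.symm ⟨u, i⟩).1, (g.symm ⟨u, i⟩).2, by simp [(g.symm ⟨u, i⟩).2]⟩) ⟨?_, ?_⟩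
  · intro i j hij
    have h1 : g.symm ⟨u, i⟩ = g.symm ⟨u, j⟩ := Subtype.ext (Subtype.mk.inj hij)
    simpa using g.symm.injective h1
  · rintro ⟨e, he, hu⟩
    simp only [dif_pos he] at hu
    rcases hg : g ⟨e, he⟩ with ⟨u', i⟩
    rw [hg] at hu
    simp only at hu
    subst hu
    exact ⟨i, Subtype.ext (by simp [← hg])⟩

/-- Distributing the ends of edges among `n` vertices: every vertex receives exactly `d` edges of
`H`, `a` edges of `M` and `b` edges of `S`. -/
theorem exists_distribution {E : Type*} [Finite E] (H M S : E → Prop) (n d a b : ℕ)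
    (ha : a ≤ 1) (hb : b ≤ 1) (had : a ≤ d) (hMH : ∀ e, M e → H e) (hHS : ∀ e, H e ∨ S e)
    (hH : Nat.card {e // H e} = d * n) (hM : Nat.card {e // M e} = a * n)
    (hS : Nat.card {e // S e} = b * n) :
    ∃ f : E → Fin n, ∀ u, Nat.card {e // H e ∧ f e = u} = d ∧
      Nat.card {e // M e ∧ f e = u} = a ∧ Nat.card {e // S e ∧ f e = u} = b := by
  classical
  rcases n.eq_zero_or_pos with rfl | hn
  · have hempty : IsEmpty E := ⟨fun e => by
      rw [mul_zero, Finite.card_eq_zero_iff] at hH hS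
      exact (hHS e).elim (fun h => hH.elim ⟨e, h⟩) (fun h => hS.elim ⟨e, h⟩)⟩
    exact ⟨hempty.elim, fun u => u.elim0⟩
  have : Nonempty (Fin n) := ⟨⟨0, hn⟩⟩
  -- Greedy in three rounds: the edges of `M`, then those of `S \ M`, then the rest of `H`. Each
  -- round fills the quota left by the previous ones.
  obtain ⟨f₁, hf₁⟩ := exists_map_natCard_fiber_eq M (fun _ : Fin n => a)
    (by rw [hM]; simp [mul_comm])
  have hMS : ∀ u, Nat.card {e // (S e ∧ M e) ∧ f₁ e = u} ≤ b := by
    intro u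
    rcases b.eq_zero_or_pos with h0 | h0
    · have h1 := natCard_subtype_mono (P := fun e => (S e ∧ M e) ∧ f₁ e = u) (Q := S)
        fun e h => h.1.1
      rw [hS, h0, zero_mul] at h1
      omega
    · have h1 := natCard_subtype_mono (P := fun e => (S e ∧ M e) ∧ f₁ e = u)
        (Q := fun e => M e ∧ f₁ e = u) fun e h => ⟨h.1.2, h.2⟩
      rw [hf₁ u] at h1
      omega
  obtain ⟨f₂, hf₂⟩ := exists_map_natCard_fiber_eq (fun e => S e ∧ ¬ M e)
    (fun u : Fin n => b - Nat.card {e // (S e ∧ M e) ∧ f₁ e = u}) (by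
      rw [Finset.sum_tsub_distrib _ fun u _ => hMS u, sum_natCard_fiber (fun e => S e ∧ M e) f₁]
      have := natCard_subtype_split S M
      simp only [Finset.sum_const, Finset.card_univ, Fintype.card_fin, smul_eq_mul]
      rw [mul_comm n b, ← hS]
      omega)
  -- A vertex gets at most one edge of `S` in the second round. If that edge is in `H`, then `H` has
  -- more edges than `M`, hence `a < d` and there is room for it.
  have hHS' : ∀ u, a + Nat.card {e // ((H e ∧ ¬ M e) ∧ S e) ∧ f₂ e = u} ≤ d := by
    intro u
    rcases Nat.eq_zero_or_pos
      (Nat.card {e // ((H e ∧ ¬ M e) ∧ S e) ∧ f₂ e = u}) with h0 | h0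
    · omega
    · have h1 := natCard_subtype_mono (P := fun e => ((H e ∧ ¬ M e) ∧ S e) ∧ f₂ e = u)
        (Q := fun e => (S e ∧ ¬ M e) ∧ f₂ e = u) fun e h => ⟨⟨h.1.2, h.1.1.2⟩, h.2⟩
      rw [hf₂ u] at h1
      have h2 := natCard_subtype_mono (P := fun e => ((H e ∧ ¬ M e) ∧ S e) ∧ f₂ e = u)
        (Q := fun e => H e ∧ ¬ M e) fun e h => h.1.1
      have h3 := natCard_subtype_split H M
      have h4 := natCard_subtype_mono (P := M) (Q := fun e => H e ∧ M e) fun e h => ⟨hMH e h, h⟩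
      have h5 : a * n < d * n := by omega
      have h6 := Nat.lt_of_mul_lt_mul_right h5
      omega
  obtain ⟨f₃, hf₃⟩ := exists_map_natCard_fiber_eq (fun e => (H e ∧ ¬ M e) ∧ ¬ S e)
    (fun u : Fin n => d - (a + Nat.card {e // ((H e ∧ ¬ M e) ∧ S e) ∧ f₂ e = u})) (by
      rw [Finset.sum_tsub_distrib _ fun u _ => hHS' u, Finset.sum_add_distrib,
        sum_natCard_fiber (fun e => (H e ∧ ¬ M e) ∧ S e) f₂]
      have h1 := natCard_subtype_split H M
      have h2 := natCard_subtype_split (fun e => H e ∧ ¬ M e) S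
      have h3 := natCard_subtype_congr (P := fun e => H e ∧ M e) (Q := M)
        fun e => and_iff_right_of_imp (hMH e)
      simp only [Finset.sum_const, Finset.card_univ, Fintype.card_fin, smul_eq_mul]
      rw [mul_comm n d, mul_comm n a, ← hH, ← hM]
      omega)
  let f : E → Fin n := fun e => if M e then f₁ e else if S e then f₂ e else f₃ e
  have hfM : ∀ e, M e → f e = f₁ e := fun e h => if_pos h
  have hfS : ∀ e, ¬ M e → S e → f e = f₂ e := fun e h h' => by simp [f, h, h']
  have hfH : ∀ e, ¬ M e → ¬ S e → f e = f₃ e := fun e h h' => by simp [f, h, h']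
  refine ⟨f, fun u => ?_⟩
  have hMu : Nat.card {e // M e ∧ f e = u} = a := by
    rw [← hf₁ u]
    exact natCard_subtype_congr fun e => and_congr_right fun h => by rw [hfM e h]
  refine ⟨?_, hMu, ?_⟩
  · have h1 := natCard_subtype_split (fun e => H e ∧ f e = u) M
    have h2 := natCard_subtype_split (fun e => (H e ∧ f e = u) ∧ ¬ M e) S
    have h3 := natCard_subtype_congr (P := fun e => (H e ∧ f e = u) ∧ M e)
      (Q := fun e => M e ∧ f e = u) fun e => by
        have := hMH e
        tauto
    have h4 := natCard_subtype_congr (P := fun e => ((H e ∧ f e = u) ∧ ¬ M e) ∧ S e)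
      (Q := fun e => ((H e ∧ ¬ M e) ∧ S e) ∧ f₂ e = u) fun e => by
        by_cases hM : M e <;> by_cases hS : S e <;> simp [hM, hS, hfS]
    have h5 := natCard_subtype_congr (P := fun e => ((H e ∧ f e = u) ∧ ¬ M e) ∧ ¬ S e)
      (Q := fun e => ((H e ∧ ¬ M e) ∧ ¬ S e) ∧ f₃ e = u) fun e => by
        by_cases hM : M e <;> by_cases hS : S e <;> simp [hM, hS, hfH]
    have h6 := hHS' u
    have h7 := hf₃ u
    omega
  · have h1 := natCard_subtype_split (fun e => S e ∧ f e = u) M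
    have h3 := natCard_subtype_congr (P := fun e => (S e ∧ f e = u) ∧ M e)
      (Q := fun e => (S e ∧ M e) ∧ f₁ e = u) fun e => by
        by_cases hM : M e <;> simp [hM, hfM]
    have h4 := natCard_subtype_congr (P := fun e => (S e ∧ f e = u) ∧ ¬ M e)
      (Q := fun e => (S e ∧ ¬ M e) ∧ f₂ e = u) fun e => by
        by_cases hM : M e <;> by_cases hS : S e <;> simp [hM, hS, hfS]
    have h5 := hMS u
    have h6 := hf₂ u
    omega

/-! ### A simple graph covering a multigraph -/

theorem pi_zmod_two_add_self {E : Type*} (p : E → ZMod 2) : p + p = 0 :=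
  funext fun _ => CharTwo.add_self_eq_zero _

theorem single_one_injective {E : Type*} [DecidableEq E] :
    Function.Injective fun e : E => (Pi.single e 1 : E → ZMod 2) := by
  intro e e' h
  by_contra hne
  have := congrFun h e
  simp [hne] at this

/-- The simple graph on `U × (E → ZMod 2)` that covers the multigraph on `U` with the edges
`e : E` such that `Q e`. -/
def liftGraph {E U : Type*} [DecidableEq E] (ends : E → Sym2 U) (Q : E → Prop) :
    SimpleGraph (U × (E → ZMod 2)) where
  -- The vectors differ in coordinate `e` only, so adjacent vertices determine `e` and parallel
  -- edges are separated.
  Adj x y := ∃ e, Q e ∧ s(x.1, y.1) = ends e ∧ x.2 + y.2 = Pi.single e 1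
  symm := ⟨fun x y ⟨e, h1, h2, h3⟩ => ⟨e, h1, Sym2.eq_swap.trans h2, (add_comm _ _).trans h3⟩⟩
  loopless := ⟨fun x ⟨e, _, _, h3⟩ => by
    have := congrFun ((pi_zmod_two_add_self x.2).symm.trans h3) e
    simp at this⟩

variable {E U : Type*} [DecidableEq E] {ends : E → Sym2 U} {Q : E → Prop}

theorem liftGraph_mono {Q' : E → Prop} (h : ∀ e, Q e → Q' e) :
    liftGraph ends Q ≤ liftGraph ends Q' := fun _ _ ⟨e, h1, h2⟩ => ⟨e, h e h1, h2⟩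

/-- Every edge `e` at `x.1` gives one neighbour: move to the other end and flip coordinate `e`. So
degrees survive the lift, and matchings lift to matchings. -/
theorem natCard_liftGraph_adj [Fintype E] [Fintype U] (x : U × (E → ZMod 2)) :
    Nat.card {y // (liftGraph ends Q).Adj x y} = Nat.card {e // Q e ∧ x.1 ∈ ends e} := by
  classical
  symm
  rw [natCard_subtype_eq, natCard_subtype_eq]
  refine Finset.card_bij (fun e he => (Sym2.Mem.other (Finset.mem_filter.1 he).2.2,
    x.2 + Pi.single e 1)) ?_ ?_ ?_
  · intro e he
    have h := (Finset.mem_filter.1 he).2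
    refine Finset.mem_filter.2 ⟨Finset.mem_univ _, e, h.1, Sym2.other_spec h.2, ?_⟩
    rw [← add_assoc, pi_zmod_two_add_self, zero_add]
  · intro e he e' he' h
    have h2 := congrArg (fun z => x.2 + z.2) h
    simp only [← add_assoc, pi_zmod_two_add_self, zero_add] at h2
    exact single_one_injective h2
  · intro y hy
    obtain ⟨e, h1, h2, h3⟩ := (Finset.mem_filter.1 hy).2
    have hmem : x.1 ∈ ends e := h2 ▸ Sym2.mem_mk_left _ _
    refine ⟨e, Finset.mem_filter.2 ⟨Finset.mem_univ _, h1, hmem⟩, Prod.ext ?_ ?_⟩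
    · exact Sym2.congr_right.1 ((Sym2.other_spec hmem).trans h2.symm)
    · simp only
      rw [← h3, ← add_assoc, pi_zmod_two_add_self, zero_add]

theorem uniqueNeighbors_liftGraph [Fintype E] [Fintype U]
    (h : ∀ u, Nat.card {e // Q e ∧ u ∈ ends e} ≤ 1) :
    UniqueNeighbors (liftGraph ends Q) := by
  intro x y z hy hz
  have h1 := h x.1
  rw [← natCard_liftGraph_adj, Finite.card_le_one_iff_subsingleton] at h1
  exact congrArg Subtype.val (h1.elim ⟨y, hy⟩ ⟨z, hz⟩)

/-- An edge has one lift for each vector at its left end; the side `T` prevents two lifts from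
agreeing with ends swapped. -/
theorem le_ncard_edgeSet_liftGraph [Fintype E] [Fintype U] {l r : E → U} {T : Set U}
    (hl : ∀ e, l e ∈ T) (hr : ∀ e, r e ∉ T) (hends : ∀ e, ends e = s(l e, r e)) :
    Nat.card {e // Q e} * Nat.card (E → ZMod 2) ≤ (liftGraph ends Q).edgeSet.ncard := by
  rw [← Nat.card_coe_set_eq, ← Nat.card_prod]
  refine Nat.card_le_card_of_injective (fun p : {e // Q e} × (E → ZMod 2) =>
    ⟨s((l p.1, p.2), (r p.1, p.2 + Pi.single p.1.1 1)), ?_⟩) ?_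
  · refine ⟨p.1, p.1.2, (hends _).symm, ?_⟩
    rw [← add_assoc, pi_zmod_two_add_self, zero_add]
  · rintro ⟨⟨e, he⟩, p⟩ ⟨⟨e', he'⟩, p'⟩ h
    rcases Sym2.eq_iff.1 (congrArg Subtype.val h) with ⟨h1, h2⟩ | ⟨h1, -⟩
    · obtain ⟨-, rfl⟩ := Prod.ext_iff.1 h1
      have h3 := (Prod.ext_iff.1 h2).2
      simp only at h3
      have h4 := add_left_cancel h3
      obtain rfl := single_one_injective h4
      rfl
    · have h3 : l e = r e' := (Prod.ext_iff.1 h1).1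
      exact absurd (h3 ▸ hl e) (hr e')

/-! ### From an integral solution to a graph with an EDCS -/

theorem natCard_sigma_fin {I : Type*} [Fintype I] (m : I → ℕ) (Q : I → Prop) [DecidablePred Q] :
    Nat.card {i : Σ e, Fin (m e) // Q i.1} = ∑ e with Q e, m e := by
  classical
  rw [natCard_subtype_eq, Finset.card_eq_sum_card_fiberwise (f := Sigma.fst)
    (t := Finset.univ.filter Q) (by intro i hi; simpa using hi)]
  refine Finset.sum_congr rfl fun e he => ?_
  have he := (Finset.mem_filter.1 he).2
  rw [Finset.filter_filter, ← natCard_subtype_eq, ← Nat.card_fin (m e)]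
  symm
  refine Nat.card_eq_of_bijective (fun i => ⟨⟨e, i⟩, he, rfl⟩) ⟨?_, ?_⟩
  · intro i j h
    simpa using h
  · rintro ⟨⟨e', i⟩, -, rfl⟩
    exact ⟨i, rfl⟩

/-- The vertices of `N(A)` and of `L \ A` are at most as many as the edges of `M`. -/
theorem HomFeasible.sum_cover_le {β βm : ℕ} {n : VP β → ℕ} {m : EP β βm → ℕ} {N : ℕ}
    (h : HomFeasible ℕ β βm n m N) :
    ∑ v : VP β with v.1.pos = Pos.NA ∨ v.1.pos = Pos.LdiffA, n v ≤ N := by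
  -- These profiles are matched in `M`, so `n v` counts the edges of `M` at `v`. By the `Xor`
  -- condition each edge of `M` is counted at most once.
  have h1 : ∀ v ∈ Finset.univ.filter fun v : VP β => v.1.pos = Pos.NA ∨ v.1.pos = Pos.LdiffA,
      n v = ∑ e : EP β βm with e.1.inM = true, if e.1.Touches v then m e else 0 := by
    intro v hv
    rw [← h.sum_M v (v.2.1 (Finset.mem_filter.1 hv).2), ← Finset.filter_filter, Finset.sum_filter]
  rw [Finset.sum_congr rfl h1, Finset.sum_comm, ← h.sum_M_eq]
  refine Finset.sum_le_sum fun e he => ?_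
  rw [← Finset.sum_filter, Finset.sum_const, smul_eq_mul, Finset.filter_filter]
  suffices hone : (Finset.univ.filter fun v : VP β => (v.1.pos = Pos.NA ∨ v.1.pos = Pos.LdiffA) ∧
      e.1.Touches v).card ≤ 1 from (Nat.mul_le_mul_right _ hone).trans_eq (one_mul _)
  have hx := e.2.2.2.2.2.2.2.2.2.2 (Finset.mem_filter.1 he).2
  have hL := e.2.1.1
  have hR := e.2.1.2
  rw [Finset.card_le_one]
  have key : ∀ v, (v.1.pos = Pos.NA ∨ v.1.pos = Pos.LdiffA) ∧ e.1.Touches v →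
      (v = e.1.left ∧ e.1.left.1.pos = Pos.LdiffA) ∨ (v = e.1.right ∧ e.1.right.1.pos = Pos.NA) := by
    rintro v ⟨hv, rfl | rfl⟩
    · left
      refine ⟨rfl, hv.resolve_left fun h => ?_⟩
      rw [h] at hL
      simp [Pos.InL] at hL
    · right
      refine ⟨rfl, hv.resolve_right fun h => ?_⟩
      rw [h] at hR
      simp [Pos.InR] at hR
  intro v hv w hw
  rcases key v (Finset.mem_filter.1 hv).2 with ⟨rfl, hv'⟩ | ⟨rfl, hv'⟩ <;>
    rcases key w (Finset.mem_filter.1 hw).2 with ⟨rfl, hw'⟩ | ⟨rfl, hw'⟩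
  · rfl
  · exact absurd hv' (hx.elim (fun h => h.2) fun h => absurd hw' h.2)
  · exact absurd hw' (hx.elim (fun h => h.2) fun h => absurd hv' h.2)
  · rfl

/-- An integral solution of the homogeneous linear program is realized, up to a factor, by a
multigraph. -/
theorem HomFeasible.exists_multigraph {β βm : ℕ} {n : VP β → ℕ} {m : EP β βm → ℕ} {N : ℕ}
    (h : HomFeasible ℕ β βm n m N) :
    ∃ l r : (Σ e, Fin (m e)) → Σ v, Fin (n v), (∀ i, (l i).1 = i.1.1.left) ∧
      (∀ i, (r i).1 = i.1.1.right) ∧ ∀ u,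
        Nat.card {i // i.1.1.inH = true ∧ u ∈ s(l i, r i)} = u.1.1.deg ∧
        Nat.card {i // i.1.1.inMstar = true ∧ u ∈ s(l i, r i)} ≤ 1 := by
  -- Each profile `v` has `n v` copies and each edge profile `e` has `m e` copies. The ends are
  -- assigned to copies separately at each `v`.
  have hdist : ∀ v : VP β, ∃ f : {i : Σ e, Fin (m e) // i.1.1.Touches v} → Fin (n v), ∀ j,
      Nat.card {i : {i : Σ e, Fin (m e) // i.1.1.Touches v} //
        i.1.1.1.inH = true ∧ f i = j} = v.1.deg ∧
      Nat.card {i : {i : Σ e, Fin (m e) // i.1.1.Touches v} //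
        i.1.1.1.inMstar = true ∧ f i = j} ≤ 1 := by
    intro v
    have hcard : ∀ Q : EP β βm → Prop, ∀ [DecidablePred Q],
        Nat.card {i : {i : Σ e, Fin (m e) // i.1.1.Touches v} // Q i.1.1} =
          ∑ e : EP β βm with Q e ∧ e.1.Touches v, m e := by
      intro Q _
      rw [← natCard_sigma_fin m fun e => Q e ∧ e.1.Touches v]
      exact (Nat.card_congr (Equiv.subtypeSubtypeEquivSubtypeInter _
        fun i : Σ e, Fin (m e) => Q i.1)).trans (natCard_subtype_congr fun i => and_comm)
    have hle : ∀ b : Bool, (if b = true then 1 else 0) ≤ 1 := by decide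
    obtain ⟨f, hf⟩ := exists_distribution
      (fun i : {i : Σ e, Fin (m e) // i.1.1.Touches v} => i.1.1.1.inH = true)
      (fun i => i.1.1.1.inM = true) (fun i => i.1.1.1.inMstar = true) (n v) v.1.deg
      (if v.1.inM = true then 1 else 0) (if v.1.inMstar = true then 1 else 0) (hle _) (hle _)
      (by
        split_ifs with hv
        · refine Nat.one_le_iff_ne_zero.2 fun h0 => ?_
          simp [v.2.2 h0] at hv
        · exact Nat.zero_le _)
      (fun i => i.1.1.2.2.2.2.2.1) (fun i => i.1.1.2.2.2.2.2.2.1)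
      (by rw [hcard fun e => e.1.inH = true, h.sum_H, Nat.cast_id])
      (by
        rw [hcard fun e => e.1.inM = true]
        split_ifs with hv
        · rw [h.sum_M v hv, one_mul]
        · rw [zero_mul]
          refine Finset.sum_eq_zero fun e he => absurd ?_ hv
          obtain ⟨hM, rfl | rfl⟩ := (Finset.mem_filter.1 he).2
          · exact (e.2.2.2.1 hM).1
          · exact (e.2.2.2.1 hM).2)
      (by
        rw [hcard fun e => e.1.inMstar = true]
        split_ifs with hv
        · rw [h.sum_Mstar v hv, one_mul]
        · rw [zero_mul]
          refine Finset.sum_eq_zero fun e he => absurd ?_ hv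
          obtain ⟨hM, rfl | rfl⟩ := (Finset.mem_filter.1 he).2
          · exact (e.2.2.2.2.1 hM).1
          · exact (e.2.2.2.2.1 hM).2)
    exact ⟨f, fun j => ⟨(hf j).1, (hf j).2.2.trans_le (hle _)⟩⟩
  choose f hf using hdist
  let l : (Σ e, Fin (m e)) → Σ v, Fin (n v) := fun i => ⟨i.1.1.left, f _ ⟨i, Or.inl rfl⟩⟩
  let r : (Σ e, Fin (m e)) → Σ v, Fin (n v) := fun i => ⟨i.1.1.right, f _ ⟨i, Or.inr rfl⟩⟩
  have hmem : ∀ u i, u ∈ s(l i, r i) ↔ ∃ h : i.1.1.Touches u.1, f u.1 ⟨i, h⟩ = u.2 := by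
    rintro ⟨v, j⟩ i
    rw [Sym2.mem_iff]
    constructor
    · rintro (h | h)
      · cases h
        exact ⟨Or.inl rfl, rfl⟩
      · cases h
        exact ⟨Or.inr rfl, rfl⟩
    · rintro ⟨h | h, hj⟩
      · simp only at h
        subst h
        exact Or.inl (Sigma.ext rfl (heq_of_eq hj.symm))
      · simp only at h
        subst h
        exact Or.inr (Sigma.ext rfl (heq_of_eq hj.symm))
  have hcard : ∀ (Q : EP β βm → Prop) (u : Σ v, Fin (n v)), Nat.card {i // Q i.1 ∧ u ∈ s(l i, r i)} =
      Nat.card {i : {i : Σ e, Fin (m e) // i.1.1.Touches u.1} // Q i.1.1 ∧ f u.1 i = u.2} := by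
    intro Q u
    refine Nat.card_congr
      { toFun := fun i => ⟨⟨i.1, ((hmem _ _).1 i.2.2).1⟩, i.2.1, ((hmem _ _).1 i.2.2).2⟩
        invFun := fun i => ⟨i.1.1, i.2.1, (hmem _ _).2 ⟨i.1.2, i.2.2⟩⟩
        left_inv := fun i => rfl
        right_inv := fun i => rfl }
  refine ⟨l, r, fun i => rfl, fun i => rfl, fun u => ⟨?_, ?_⟩⟩
  · rw [hcard fun e => e.1.inH = true]
    exact (hf u.1 u.2).1
  · rw [hcard fun e => e.1.inMstar = true]
    exact (hf u.1 u.2).2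

/-- An integral solution of the homogeneous linear program gives a bipartite graph with an EDCS
whose ratio of matching numbers is at least the objective. -/
theorem HomFeasible.exists_graph {β βm : ℕ} {n : VP β → ℕ} {m : EP β βm → ℕ} {N : ℕ}
    (h : HomFeasible ℕ β βm n m N) (hN : 0 < N) :
    ∃ (V : Type) (_ : Fintype V) (G H : SimpleGraph V) (_ : DecidableRel H.Adj) (c : ℕ),
      G.IsBipartite ∧ IsEDCS β βm G H ∧ 0 < matchingNumber H ∧ matchingNumber H ≤ N * c ∧
        (∑ e : EP β βm with e.1.inMstar = true, m e) * c ≤ matchingNumber G := by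
  classical
  obtain ⟨l, r, hl, hr, hdeg⟩ := h.exists_multigraph
  let T : Set (Σ v : VP β, Fin (n v)) := {u | u.1.1.pos.InL}
  have hlT : ∀ i, l i ∈ T := fun i => by
    show (l i).1.1.pos.InL
    rw [hl]
    exact i.1.2.1.1
  have hrT : ∀ i, r i ∉ T := fun i hi => by
    have h1 : (r i).1.1.pos.InL := hi
    have h2 := i.1.2.1.2
    rw [hr] at h1
    rcases h2 with h2 | h2 <;> rw [h2] at h1 <;> simp [Pos.InL] at h1
  let ends := fun i => s(l i, r i)
  let G := liftGraph ends fun _ => True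
  let H := liftGraph ends fun i => i.1.1.inH = true
  let K := liftGraph ends fun i => i.1.1.inMstar = true
  have hHG : H ≤ G := liftGraph_mono fun _ _ => trivial
  have hKG : K ≤ G := liftGraph_mono fun _ _ => trivial
  have hside : ∀ x y, G.Adj x y → (x ∈ Prod.fst ⁻¹' T ↔ y ∉ Prod.fst ⁻¹' T) := by
    rintro x y ⟨i, -, he, -⟩
    simp only [Set.mem_preimage]
    rcases Sym2.eq_iff.1 he with ⟨h1, h2⟩ | ⟨h1, h2⟩ <;> rw [h1, h2] <;> simp [hlT, hrT]
  have hHdeg : ∀ x, H.degree x = x.1.1.1.deg := by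
    intro x
    rw [← (hdeg x.1).1, ← SimpleGraph.card_neighborSet_eq_degree, ← Nat.card_eq_fintype_card]
    exact natCard_liftGraph_adj x
  have hsum : ∀ x y i, s(x.1, y.1) = ends i →
      H.degree x + H.degree y = i.1.1.left.1.deg + i.1.1.right.1.deg := by
    intro x y i he
    rw [hHdeg, hHdeg]
    rcases Sym2.eq_iff.1 he with ⟨h1, h2⟩ | ⟨h1, h2⟩ <;> rw [h1, h2, hl, hr]
    exact add_comm _ _
  refine ⟨_, inferInstance, G, H, inferInstance, Nat.card ((Σ e, Fin (m e)) → ZMod 2),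
    ?_, ⟨hHG, ?_, ?_⟩, ?_, ?_, ?_⟩
  · refine ⟨SimpleGraph.Coloring.mk (fun x => if x.1 ∈ T then (0 : Fin 2) else 1) ?_⟩
    intro x y hxy
    have := hside x y hxy
    simp only [Set.mem_preimage] at this
    by_cases hy : y.1 ∈ T <;> simp [this, hy]
  · rintro x y ⟨i, hi, he, -⟩
    rw [hsum x y i he]
    exact i.1.2.2.2.2.2.2.2.1 hi
  · rintro x y ⟨i, -, he, hxy⟩ hH
    rw [hsum x y i he]
    refine i.1.2.2.2.2.2.2.2.2.1 ?_
    by_contra hi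
    exact hH ⟨i, by simpa using hi, he, hxy⟩
  -- As `N > 0`, some edge of `M` has a copy, and its lift is an edge of `H`.
  · rw [Nat.pos_iff_ne_zero]
    intro h0
    have hbot := eq_bot_of_matchingNumber_eq_zero (fun a b hab => hside a b (hHG hab)) h0
    obtain ⟨e, he, hme⟩ : ∃ e ∈ Finset.univ.filter fun e : EP β βm => e.1.inM = true, m e ≠ 0 := by
      by_contra! hall
      rw [← h.sum_M_eq, Finset.sum_eq_zero hall] at hN
      exact lt_irrefl _ hN
    let i : Σ e, Fin (m e) := ⟨e, 0, Nat.pos_of_ne_zero hme⟩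
    have hadj : H.Adj (l i, 0) (r i, Pi.single i 1) :=
      ⟨i, e.2.2.2.2.2.1 (Finset.mem_filter.1 he).2, rfl, zero_add _⟩
    rw [hbot] at hadj
    exact hadj
  -- No edge of `H` joins `A` to `R \ N(A)`, so the positions `N(A)` and `L \ A` cover `H`.
  · refine (matchingNumber_le_card_cover (fun a b hab => hside a b (hHG hab))
      (C := Finset.univ.filter fun x =>
        x.1.1.1.pos = Pos.NA ∨ x.1.1.1.pos = Pos.LdiffA) ?_).trans ?_
    · rintro x y ⟨i, hi, he, -⟩
      have h1 := i.1.2.2.2.2.2.2.2.2.2.1 hi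
      have h2 : i.1.1.left.1.pos = Pos.LdiffA ∨ i.1.1.right.1.pos = Pos.NA := by
        rcases i.1.2.1.1 with hA | hA
        · exact Or.inr (i.1.2.1.2.resolve_right fun hR => h1 ⟨hA, hR⟩)
        · exact Or.inl hA
      simp only [Finset.mem_filter, Finset.mem_univ, true_and]
      rcases Sym2.eq_iff.1 he with ⟨h1, h2⟩ | ⟨h1, h2⟩ <;> rw [h1, h2, hl, hr] <;> tauto
    · rw [← natCard_subtype_eq]
      rw [Nat.card_congr (Equiv.prodSubtypeFstEquivSubtypeProd
        (p := fun u : Σ v : VP β, Fin (n v) => u.1.1.pos = Pos.NA ∨ u.1.1.pos = Pos.LdiffA)),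
        Nat.card_prod, natCard_sigma_fin n fun v => v.1.pos = Pos.NA ∨ v.1.pos = Pos.LdiffA]
      exact Nat.mul_le_mul_right _ h.sum_cover_le
  · rw [← natCard_sigma_fin m fun e => e.1.inMstar = true]
    exact (le_ncard_edgeSet_liftGraph hlT hrT fun _ => rfl).trans
      (ncard_le_matchingNumber hKG (uniqueNeighbors_liftGraph fun u => (hdeg u).2))

/-! ### The two halves of the theorem -/

theorem exists_lpFeasible {β βm : ℕ} (hβ : 2 ≤ β) :
    ∃ (x : VP β → ℝ) (y : EP β βm → ℝ), LPFeasible β βm x y := by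
  -- A single edge is an EDCS of itself because `2 ≤ β`.
  let K : SimpleGraph (Fin 2) := ⊤
  have hbip : K.IsBipartite := ⟨SimpleGraph.Coloring.mk id fun h => h⟩
  have hE : IsEDCS β βm K K :=
    ⟨le_rfl, fun u v _ => by simpa [K] using hβ, fun u v h h' => absurd h h'⟩
  obtain ⟨L, hL⟩ := exists_side_of_isBipartite hbip
  have hpos : 0 < matchingNumber K := by
    rw [Nat.pos_iff_ne_zero]
    intro h0
    have hadj : K.Adj 0 1 := by simp [K]
    rw [eq_bot_of_matchingNumber_eq_zero hL h0] at hadj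
    exact hadj
  obtain ⟨x, y, hxy, -⟩ := hE.exists_lpFeasible (by omega) hbip hpos
  exact ⟨x, y, hxy⟩

theorem IsEDCS.matchingNumber_le {V : Type*} [Fintype V] {G H : SimpleGraph V}
    [DecidableRel H.Adj] {β βm : ℕ} {r : ℝ} (hβm : 1 ≤ βm) (hβ : 0 < β) (hG : G.IsBipartite)
    (hE : IsEDCS β βm G H) (hr : IsLPOptimalValue β βm r) :
    (matchingNumber G : ℝ) ≤ r * matchingNumber H := by
  obtain ⟨L, hL⟩ := exists_side_of_isBipartite hG
  rcases (matchingNumber H).eq_zero_or_pos with h0 | hpos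
  -- The ratio is undefined here. All degrees in `H` vanish, so `1 ≤ βm` excludes edges of `G`.
  · have hH := eq_bot_of_matchingNumber_eq_zero (fun a b h => hL a b (hE.le h)) h0
    have hG0 : G = ⊥ := by
      ext a b
      simp only [SimpleGraph.bot_adj, iff_false]
      intro hab
      have hdeg : ∀ u, H.degree u = 0 := fun u => Nat.eq_zero_of_not_pos fun h => by
        obtain ⟨w, hw⟩ := (H.degree_pos_iff_exists_adj u).1 h
        rwa [hH] at hw
      have := hE.le_deg_add a b hab (by simp [hH])
      rw [hdeg, hdeg] at this
      omega
    rw [hG0, ← hH, h0]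
    simp
  · obtain ⟨x, y, hxy, hobj⟩ := hE.exists_lpFeasible hβ hG hpos
    have := hr.2 ⟨x, y, hxy, hobj⟩
    rwa [div_le_iff₀ (Nat.cast_pos.2 hpos)] at this

end EDCS

theorem theorem1 (β βm : ℕ) (hβm : 1 ≤ βm) (hβ : βm < β) :
    ∃ r : ℝ, EDCS.IsLPOptimalValue β βm r ∧
      (∀ (V : Type*) [Fintype V] (G H : SimpleGraph V) [DecidableRel H.Adj],
        G.IsBipartite → EDCS.IsEDCS β βm G H →
          (EDCS.matchingNumber G : ℝ) ≤ r * (EDCS.matchingNumber H : ℝ)) ∧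
      (∃ (V : Type) (_ : Fintype V) (G H : SimpleGraph V) (_ : DecidableRel H.Adj),
        G.IsBipartite ∧ EDCS.IsEDCS β βm G H ∧ 0 < EDCS.matchingNumber H ∧
          (EDCS.matchingNumber G : ℝ) = r * (EDCS.matchingNumber H : ℝ)) := by
  obtain ⟨r, hr⟩ := EDCS.exists_isLPOptimalValue hβm (EDCS.exists_lpFeasible (by omega : 2 ≤ β))
  refine ⟨r, hr, fun V _ G H _ hG hE => hE.matchingNumber_le hβm (by omega) hG hr, ?_⟩
  obtain ⟨n, m, N, hN, hfeas, hobj⟩ := hr.exists_nat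
  obtain ⟨V, hV, G, H, hH, c, hG, hE, hpos, hleH, hleG⟩ := hfeas.exists_graph hN
  refine ⟨V, hV, G, H, hH, hG, hE, hpos, le_antisymm
    (hE.matchingNumber_le hβm (by omega) hG hr) ?_⟩
  have hr0 : 0 ≤ r := by
    obtain ⟨x, y, hxy, rfl⟩ := hr.1
    exact Finset.sum_nonneg fun e _ => hxy.edge_nonneg e
  -- The fibre size `c` scales the bounds on both matching numbers and cancels from the ratio.
  calc r * (EDCS.matchingNumber H : ℝ) ≤ r * (N * c : ℕ) :=
        mul_le_mul_of_nonneg_left (Nat.cast_le.2 hleH) hr0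
    _ = ((∑ e : EDCS.EP β βm with e.1.inMstar = true, m e) * c : ℕ) := by
        rw [Nat.cast_mul, Nat.cast_mul, hobj, mul_assoc]
    _ ≤ EDCS.matchingNumber G := Nat.cast_le.2 hleG
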